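/- **Definitions.** For a finite alphabet $\Sigma$ let $\diamondsuit,\overline{\diamondsuit}$ be two new symbols (an opening and a closing bracket). A *binary flattened tree grammar* (BFG) over $\Sigma$ is a context-free grammar with terminal alphabet $\Sigma\cup\{\diamondsuit,\overline{\diamondsuit}\}$ and finitely many productions, each of the form $N\to t$, $N\to\diamondsuit\,\overline{\diamondsuit}$ or $N\to\diamondsuit N_1N_2\overline{\diamondsuit}$, where $t\in\Sigma$ and $N,N_1,N_2$ are nonterminals. (Such grammars generate exactly the flattenings of languages of binary trees recognized by finite tree automata.) A *nested word* over $\Sigma$ is given by a word over the tagged alphabet consisting of a call, an internal and a return copy of each letter of $\Sigma$. A *visibly pushdown automaton* (VPA) over this alphabet is a nondeterministic pushdown automaton which starts with an empty stack, pushes exactly one symbol on each call, leaves the stack unchanged on each internal letter, pops exactly one symbol on each return (if the stack is empty, it sees this and leaves the stack empty), and accepts by final state. A language of nested words is regular if it is the language $L(A)$ of some VPA $A$. Two languages $L_1,L_2$ over the same finite alphabet are *separable* if there is a regular language $R$ of words with $L_1\subseteq R$ and $L_2\cap R=\emptyset$. A language $L_2$ is a *regular restriction* of $L_1$ if there is a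 regular language $R$ of words with $R\cap L_1=L_2$. A problem is *decidable* if some algorithm halts with the correct yes/no answer on every input that the problem allows (its behaviour on other inputs is irrelevant), and *undecidable* otherwise. **Theorem.** The following three problems are undecidable. 1. (BFG-SEPARABILITY) Input: a finite alphabet $\Sigma$ and two BFGs $G_1,G_2$ over $\Sigma$ such that $L(G_1)\cap L(G_2)=\emptyset$. Question: are $L(G_1)$ and $L(G_2)$ separable? 2. Input: a finite alphabet $\Sigma$ and two VPAs $A_1,A_2$ over the tagged alphabet of $\Sigma$ such that $L(A_1)\cap L(A_2)=\emptyset$. Question: are $L(A_1)$ and $L(A_2)$ separable? 3. Input: a finite alphabet $\Sigma$ and two VPAs $A_1,A_2$ over the tagged alphabet of $\Sigma$. Question: is $L(A_2)$ a regular restriction of $L(A_1)$? -/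

import Mathlib

/-! ## Decision problems with a promise -/

/-- A decision problem has instances `i : ι`, written down as elements `code i` of an
effectively encoded type `α`; only instances satisfying `promise` are legal inputs, and the
question is whether `answer i` holds.  The problem is decidable if some algorithm (partial
recursive function) halts with the right answer on every legal input.  Nothing is required of
the algorithm on other inputs. -/
def DecidableProblem {ι α : Type} [Primcodable α] (code : ι → α) (promise answer : ι → Prop) :
    Prop :=
  ∃ f : α →. Bool, Partrec f ∧
    ∀ i, promise i → ∃ b ∈ f (code i), (b = true ↔ answer i)

/-! ## Regular separability and regular restriction -/

/-- Some regular language contains `L₁` and is disjoint from `L₂`. -/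
def RegularSeparable {α : Type} (L₁ L₂ : Language α) : Prop :=
  ∃ R : Language α, R.IsRegular ∧ (∀ w ∈ L₁, w ∈ R) ∧ ∀ w ∈ L₂, w ∉ R

/-- `L₂` is a regular restriction of `L₁`: it is the intersection of `L₁` with a regular
language. -/
def RegularRestriction {α : Type} (L₁ L₂ : Language α) : Prop :=
  ∃ R : Language α, R.IsRegular ∧ R ⊓ L₁ = L₂

/-! ## Binary flattened tree grammars -/

/-- The alphabet `σ` together with two new symbols, an opening and a closing bracket. -/
inductive FlatSymbol (σ : Type) : Type
  | letter (t : σ)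
  | opening
  | closing
  deriving DecidableEq

/-- Right-hand sides of productions of a binary flattened tree grammar over `σ`, with natural
numbers as nonterminals. -/
inductive BFGBody (σ : Type) : Type
  | letter (t : σ)
  | leaf
  | node (N₁ N₂ : ℕ)

/-- The word of terminals and nonterminals which a right-hand side stands for: a letter `t` of
`σ`, or `opening closing`, or `opening N₁ N₂ closing`. -/
def BFGBody.output {σ : Type} : BFGBody σ → List (Symbol (FlatSymbol σ) ℕ)
  | .letter t => [.terminal (.letter t)]
  | .leaf => [.terminal .opening, .terminal .closing]
  | .node N₁ N₂ =>
      [.terminal .opening, .nonterminal N₁, .nonterminal N₂, .terminal .closing]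

/-- A binary flattened tree grammar over `σ`: a start nonterminal and a finite list of
productions `N → body`. -/
structure BFG (σ : Type) : Type where
  start : ℕ
  rules : List (ℕ × BFGBody σ)

/-- The context-free grammar that a binary flattened tree grammar is. -/
def BFG.toCFG {σ : Type} [DecidableEq σ] (G : BFG σ) : ContextFreeGrammar (FlatSymbol σ) where
  NT := ℕ
  initial := G.start
  rules := (G.rules.map fun r => ⟨r.1, r.2.output⟩).toFinset

/-- The language generated by a binary flattened tree grammar. -/
def BFG.language {σ : Type} [DecidableEq σ] (G : BFG σ) : Language (FlatSymbol σ) :=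
  G.toCFG.language

/-- Right-hand sides as plain data; the letters of the alphabet `Fin k` are written as numbers. -/
def BFGBody.code {k : ℕ} : BFGBody (Fin k) → ℕ ⊕ Unit ⊕ ℕ × ℕ
  | .letter t => .inl t
  | .leaf => .inr (.inl ())
  | .node N₁ N₂ => .inr (.inr (N₁, N₂))

/-- A binary flattened tree grammar as plain data: its start symbol and its productions. -/
def BFG.code {k : ℕ} (G : BFG (Fin k)) : ℕ × List (ℕ × (ℕ ⊕ Unit ⊕ ℕ × ℕ)) :=
  (G.start, G.rules.map fun r => (r.1, r.2.code))

/-- Two binary flattened tree grammars over a common finite alphabet, which is part of the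
input. -/
structure BFGPair : Type where
  k : ℕ
  fst : BFG (Fin k)
  snd : BFG (Fin k)

/-- The input word: the size of the alphabet and the two grammars. -/
def BFGPair.code (p : BFGPair) :
    ℕ × (ℕ × List (ℕ × (ℕ ⊕ Unit ⊕ ℕ × ℕ))) × (ℕ × List (ℕ × (ℕ ⊕ Unit ⊕ ℕ × ℕ))) :=
  (p.k, p.fst.code, p.snd.code)

/-! ## Visibly pushdown automata, i.e. finite automata on nested words -/

/-- The tagged alphabet over `σ`: every letter has a call, an internal and a return version.
Words over the tagged alphabet are the (linear encodings of) nested words over `σ`. -/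
inductive Tagged (σ : Type) : Type
  | call (a : σ)
  | internal (a : σ)
  | ret (a : σ)

/-- A nondeterministic visibly pushdown automaton over the tagged alphabet of `σ`, with natural
numbers as states and stack symbols and finitely many transitions.
* `(q, a, q', γ) ∈ calls`: in state `q`, reading the call `a`, go to `q'` and push `γ`;
* `(q, a, q') ∈ internals`: in state `q`, reading the internal letter `a`, go to `q'`;
* `(q, a, some γ, q') ∈ returns`: in state `q` with `γ` on top of the stack, reading the return
  `a`, pop `γ` and go to `q'`;
* `(q, a, none, q') ∈ returns`: in state `q` at the bottom of the stack, reading the return `a`,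
  go to `q'`. -/
structure VPA (σ : Type) : Type where
  initial : List ℕ
  final : List ℕ
  calls : List (ℕ × σ × ℕ × ℕ)
  internals : List (ℕ × σ × ℕ)
  returns : List (ℕ × σ × Option ℕ × ℕ)

/-- One step between configurations (state and stack, top first, without the bottom marker). -/
inductive VPA.Step {σ : Type} (A : VPA σ) : ℕ × List ℕ → Tagged σ → ℕ × List ℕ → Prop
  | call {q q' γ : ℕ} {a : σ} {s : List ℕ} (h : (q, a, q', γ) ∈ A.calls) :
      A.Step (q, s) (.call a) (q', γ :: s)
  | internal {q q' : ℕ} {a : σ} {s : List ℕ} (h : (q, a, q') ∈ A.internals) :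
      A.Step (q, s) (.internal a) (q', s)
  | pop {q q' γ : ℕ} {a : σ} {s : List ℕ} (h : (q, a, some γ, q') ∈ A.returns) :
      A.Step (q, γ :: s) (.ret a) (q', s)
  | bottom {q q' : ℕ} {a : σ} (h : (q, a, none, q') ∈ A.returns) :
      A.Step (q, []) (.ret a) (q', [])

/-- Runs of a visibly pushdown automaton on a word. -/
inductive VPA.Run {σ : Type} (A : VPA σ) :
    ℕ × List ℕ → List (Tagged σ) → ℕ × List ℕ → Prop
  | nil (c : ℕ × List ℕ) : A.Run c [] c
  | cons {c c' c'' : ℕ × List ℕ} {x : Tagged σ} {w : List (Tagged σ)}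
      (h : A.Step c x c') (hw : A.Run c' w c'') : A.Run c (x :: w) c''

/-- The language of a visibly pushdown automaton: words with a run from an initial state with
empty stack to a final state (with any stack). -/
def VPA.language {σ : Type} (A : VPA σ) : Language (Tagged σ) :=
  {w | ∃ q₀ ∈ A.initial, ∃ q ∈ A.final, ∃ s : List ℕ, A.Run (q₀, []) w (q, s)}

/-- A visibly pushdown automaton as plain data; the letters of the alphabet `Fin k` are written
as numbers. -/
def VPA.code {k : ℕ} (A : VPA (Fin k)) :
    List ℕ × List ℕ × List (ℕ × ℕ × ℕ × ℕ) × List (ℕ × ℕ × ℕ) ×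
      List (ℕ × ℕ × Option ℕ × ℕ) :=
  (A.initial, A.final,
    A.calls.map fun x => (x.1, x.2.1.val, x.2.2),
    A.internals.map fun x => (x.1, x.2.1.val, x.2.2),
    A.returns.map fun x => (x.1, x.2.1.val, x.2.2))

/-- Two visibly pushdown automata over the tagged version of a common finite alphabet, which is
part of the input. -/
structure VPAPair : Type where
  k : ℕ
  fst : VPA (Fin k)
  snd : VPA (Fin k)

/-- The input word: the size of the alphabet and the two automata. -/
def VPAPair.code (p : VPAPair) :
    ℕ ×
    (List ℕ × List ℕ × List (ℕ × ℕ × ℕ × ℕ) × List (ℕ × ℕ × ℕ) ×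
      List (ℕ × ℕ × Option ℕ × ℕ)) ×
    (List ℕ × List ℕ × List (ℕ × ℕ × ℕ × ℕ) × List (ℕ × ℕ × ℕ) ×
      List (ℕ × ℕ × Option ℕ × ℕ)) :=
  (p.k, p.fst.code, p.snd.code)

/-!
Computations of a fixed universal machine are turned into separation problems, so that a decision
procedure would solve the halting problem.

The machine is Mathlib's `TM2` machine for partial recursive functions; it runs a given program on
the input `0`. Its statements are executed one by one by a stack machine, and configurations are
written as words such that a step replaces the first letter and one later factor
(`StackMachine.rewrites_iff`, `exists_universal_rewriting`). Two languages of sequences of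
configurations, separated by marks and followed by a block of ticks, are considered. Words
of the first one start with the initial configuration, and then come `m` pairs of a reversed
configuration and its successor, and exactly `m` ticks. Words of the second one consist of `m` pairs
of a configuration and its reversed successor, one more configuration, and more than `m` ticks. Both
languages are context-free, as each pair is checked like a palindrome and counting the ticks
nests the pairs. They are disjoint, since the number of separators bounds the number of ticks from
different sides. The constraints of the two languages interlock: together they force the
sequence to be the computation.

* If the computation terminates, then no sequence satisfies both constraints for longer than the
  computation; hence a prefix of bounded length tells the two languages apart, and a finite
  automaton can read that prefix (`prefixSeparated_of_dom`).
* If it is infinite, then the prefix of the computation with `m` pairs belongs to the first language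
  with `m` ticks and to the second one with `2 m` ticks, and for suitable `m` a given finite
  automaton does not notice the difference (`not_regularSeparable_of_not_dom`).

A context-free grammar becomes a binary flattened tree grammar by making every production build a
node and by allowing extra nodes with a blank child. The brackets then carry no information for a
finite automaton: as its transition monoid is finite, every word has a tree, with enough padding,
whose action is determined by the word (`exists_flatGen_act`). Therefore the tree grammars are
separable exactly if the word grammars are (`regularSeparable_padRules_iff`). A visibly pushdown
automaton recognizes the flattened trees by keeping the pending nonterminals of the current level
in its state and those of outer levels on its stack (`mem_vpaOf_language`). Finally, a language is
a regular restriction of its union with a disjoint language exactly if it is separable from the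
latter (`regularRestriction_iff`), and automata for unions are obtained from two initial states.

Only the input of the machine depends on the program, and it enters the grammars as a word
which is put in front of a fixed language; hence the reductions are primitive recursive.
-/

/-! ### Automata and finite monoids -/

/-- Every element of a finite monoid has an idempotent positive power. -/
theorem exists_isIdempotentElem_pow {M : Type*} [Monoid M] [Finite M] (x : M) :
    ∃ n : ℕ, IsIdempotentElem (x ^ (n + 1)) := by
  obtain ⟨i, j, hij, h⟩ := Finite.exists_ne_map_eq_of_infinite (fun n : ℕ => x ^ n)
  wlog hlt : i < j generalizing i j
  · exact this j i hij.symm h.symm (by omega)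
  obtain ⟨p, rfl⟩ := Nat.exists_eq_add_of_lt hlt
  have hper : ∀ m, i ≤ m → x ^ (m + (p + 1)) = x ^ m := by
    intro m hm
    obtain ⟨d, rfl⟩ := Nat.exists_eq_add_of_le hm
    have h' : x ^ i = x ^ (i + p + 1) := h
    calc x ^ (i + d + (p + 1)) = x ^ (i + p + 1) * x ^ d := by rw [← pow_add]; congr 1; omega
      _ = x ^ (i + d) := by rw [← h', ← pow_add]
  have hmul : ∀ k m, i ≤ m → x ^ (m + k * (p + 1)) = x ^ m := by
    intro k
    induction k with
    | zero => intro m _; simp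
    | succ k ih =>
      intro m hm
      rw [show m + (k + 1) * (p + 1) = (m + (p + 1)) + k * (p + 1) by ring, ih _ (by omega),
        hper m hm]
  refine ⟨(i + 1) * (p + 1) - 1, ?_⟩
  have h1 : (i + 1) * (p + 1) - 1 + 1 = (i + 1) * (p + 1) :=
    Nat.sub_add_cancel (Nat.mul_pos (by omega) (by omega))
  rw [h1, IsIdempotentElem, ← pow_add]
  exact hmul (i + 1) _ (by nlinarith)

/-- Two elements of a finite monoid have idempotent powers with a common positive exponent. -/
theorem exists_isIdempotentElem_pow₂ {M : Type*} [Monoid M] [Finite M] (x y : M) :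
    ∃ n : ℕ, IsIdempotentElem (x ^ (n + 1)) ∧ IsIdempotentElem (y ^ (n + 1)) := by
  obtain ⟨m, hm⟩ := exists_isIdempotentElem_pow x
  obtain ⟨n, hn⟩ := exists_isIdempotentElem_pow y
  refine ⟨(m + 1) * (n + 1) - 1, ?_⟩
  rw [Nat.sub_add_cancel (Nat.mul_pos (by omega) (by omega))]
  exact ⟨pow_mul x _ _ ▸ hm.pow _, mul_comm (m + 1) (n + 1) ▸ pow_mul y _ _ ▸ hn.pow _⟩

/-- The transformation of the state set which a word induces; the order of multiplication is
reversed so that concatenation becomes multiplication. -/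
def DFA.act {α σ : Type*} (M : DFA α σ) (w : List α) : (Function.End σ)ᵐᵒᵖ :=
  MulOpposite.op fun s => M.evalFrom s w

theorem DFA.act_append {α σ : Type*} (M : DFA α σ) (u v : List α) :
    M.act (u ++ v) = M.act u * M.act v := by
  apply MulOpposite.unop_injective
  funext s
  exact M.evalFrom_of_append s u v

theorem DFA.act_cons {α σ : Type*} (M : DFA α σ) (a : α) (v : List α) :
    M.act (a :: v) = M.act [a] * M.act v := M.act_append [a] v

theorem DFA.act_replicate {α σ : Type*} (M : DFA α σ) (a : α) (n : ℕ) :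
    M.act (List.replicate n a) = M.act [a] ^ n := by
  induction n with
  | zero => rfl
  | succ n ih => rw [List.replicate_succ, DFA.act_cons, ih, pow_succ']

theorem DFA.mem_accepts_iff_of_act_eq {α σ : Type*} (M : DFA α σ) {u v : List α}
    (h : M.act u = M.act v) : u ∈ M.accepts ↔ v ∈ M.accepts := by
  have : M.eval u = M.eval v := congrFun (congrArg MulOpposite.unop h) M.start
  rw [DFA.mem_accepts, DFA.mem_accepts, this]

instance {σ : Type*} [Finite σ] : Finite (Function.End σ)ᵐᵒᵖ :=
  have : Finite (Function.End σ) := inferInstanceAs (Finite (σ → σ))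
  Finite.of_equiv _ MulOpposite.opEquiv

/-! ### Transfer of regular separability -/

theorem Language.IsRegular.preimage_map {α β : Type*} {R : Language β} (hR : R.IsRegular)
    (f : α → β) : Language.IsRegular ({w | w.map f ∈ R} : Language α) := by
  obtain ⟨σ, _, M, rfl⟩ := hR
  exact ⟨σ, inferInstance, M.comap f, by rw [DFA.accepts_comap]; rfl⟩

theorem RegularSeparable.of_map {α β : Type} (f : α → β) {L₁ L₂ : Language α}
    {K₁ K₂ : Language β} (h : RegularSeparable K₁ K₂) (h₁ : ∀ w ∈ L₁, w.map f ∈ K₁)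
    (h₂ : ∀ w ∈ L₂, w.map f ∈ K₂) : RegularSeparable L₁ L₂ := by
  obtain ⟨R, hR, hR₁, hR₂⟩ := h
  exact ⟨_, hR.preimage_map f, fun w hw => hR₁ _ (h₁ w hw), fun w hw => hR₂ _ (h₂ w hw)⟩

/-- Under a letter-to-letter map with a left inverse, languages are separable exactly if their
images are. -/
theorem regularSeparable_map_iff {α β : Type} {f : α → β} {g : β → α}
    (hgf : Function.LeftInverse g f) {L₁ L₂ : Language α} {K₁ K₂ : Language β}
    (h₁ : ∀ w, w ∈ K₁ ↔ ∃ x ∈ L₁, w = x.map f) (h₂ : ∀ w, w ∈ K₂ ↔ ∃ x ∈ L₂, w = x.map f) :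
    RegularSeparable K₁ K₂ ↔ RegularSeparable L₁ L₂ := by
  have hmap : ∀ x : List α, (x.map f).map g = x := fun x => by
    rw [List.map_map, hgf.comp_eq_id, List.map_id]
  constructor
  · exact fun h => h.of_map f (fun w hw => (h₁ _).2 ⟨w, hw, rfl⟩) fun w hw => (h₂ _).2 ⟨w, hw, rfl⟩
  · refine fun h => h.of_map g (fun w hw => ?_) fun w hw => ?_
    · obtain ⟨x, hx, rfl⟩ := (h₁ _).1 hw
      rwa [hmap]
    · obtain ⟨x, hx, rfl⟩ := (h₂ _).1 hw
      rwa [hmap]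

/-- Two languages have a uniform bound within which any two of their words differ. -/
def PrefixSeparated {α : Type} (A B : Set (List α)) : Prop :=
  ∃ N : ℕ, ∀ u ∈ A, ∀ v ∈ B, u.take N ≠ v.take N

/-- Whether a word has a property that depends on its prefix of length `N` only can be
recognized by an automaton whose states are the words of length at most `N`. -/
theorem isRegular_of_take {α : Type} [Finite α] (N : ℕ) (P : Set (List α)) :
    Language.IsRegular ({w | w.take N ∈ P} : Language α) := by
  have : Finite {l : List α // l.length ≤ N} := (List.finite_length_le α N).to_subtype
  have := Fintype.ofFinite {l : List α // l.length ≤ N}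
  let M : DFA α {l : List α // l.length ≤ N} :=
    { step := fun s a => ⟨(s.1 ++ [a]).take N, by simp⟩
      start := ⟨[], by simp⟩
      accept := {s | s.1 ∈ P} }
  have hM : ∀ w, (M.eval w).1 = w.take N := by
    intro w
    induction w using List.reverseRecOn with
    | nil => simp [M]
    | append_singleton w a ih =>
      rw [DFA.eval_append_singleton]
      change ((M.eval w).1 ++ [a]).take N = _
      rw [ih]
      rcases le_total N w.length with h | h
      · rw [List.take_append_of_le_length h, List.take_append_of_le_length (by simp [h]),
          List.take_take, min_self]
      · rw [List.take_of_length_le h]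
  refine ⟨_, inferInstance, M, ?_⟩
  ext w
  rw [DFA.mem_accepts]
  change (M.eval w).1 ∈ P ↔ _
  rw [hM]
  rfl

theorem PrefixSeparated.regularSeparable {α : Type} [Finite α] {L₁ L₂ : Language α}
    (h : PrefixSeparated {w | w ∈ L₁} {w | w ∈ L₂}) : RegularSeparable L₁ L₂ := by
  obtain ⟨N, hN⟩ := h
  exact ⟨_, isRegular_of_take N {x | ∃ u ∈ L₁, u.take N = x}, fun w hw => ⟨w, hw, rfl⟩,
    fun v hv ⟨u, hu, huv⟩ => hN u hu v hv huv⟩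

/-! ### Flattened trees generated by a binary flattened tree grammar -/

/-- `FlatGen R N w`: the word `w` is the flattening of a tree which the productions `R` generate
from the nonterminal `N`. -/
inductive FlatGen {σ : Type} (R : List (ℕ × BFGBody σ)) : ℕ → List (FlatSymbol σ) → Prop
  | letter {N : ℕ} {t : σ} (h : (N, .letter t) ∈ R) : FlatGen R N [.letter t]
  | leaf {N : ℕ} (h : (N, .leaf) ∈ R) : FlatGen R N [.opening, .closing]
  | node {N N₁ N₂ : ℕ} {u v : List (FlatSymbol σ)} (h : (N, .node N₁ N₂) ∈ R)
      (hu : FlatGen R N₁ u) (hv : FlatGen R N₂ v) :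
      FlatGen R N (.opening :: u ++ v ++ [.closing])

/-- `FormGen R s w`: the word `w` arises from the sentential form `s` by putting a generated
flattened tree for every nonterminal. -/
inductive FormGen {σ : Type} (R : List (ℕ × BFGBody σ)) :
    List (Symbol (FlatSymbol σ) ℕ) → List (FlatSymbol σ) → Prop
  | nil : FormGen R [] []
  | terminal {a : FlatSymbol σ} {s : List (Symbol (FlatSymbol σ) ℕ)} {w : List (FlatSymbol σ)}
      (h : FormGen R s w) : FormGen R (.terminal a :: s) (a :: w)
  | nonterminal {N : ℕ} {s : List (Symbol (FlatSymbol σ) ℕ)} {u w : List (FlatSymbol σ)}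
      (hu : FlatGen R N u) (h : FormGen R s w) : FormGen R (.nonterminal N :: s) (u ++ w)

theorem FormGen.append {σ : Type} {R : List (ℕ × BFGBody σ)}
    {s t : List (Symbol (FlatSymbol σ) ℕ)} {u v : List (FlatSymbol σ)} (hu : FormGen R s u)
    (hv : FormGen R t v) : FormGen R (s ++ t) (u ++ v) := by
  induction hu with
  | nil => exact hv
  | terminal _ ih => exact .terminal ih
  | nonterminal hu _ ih => rw [List.append_assoc]; exact .nonterminal hu ih

theorem FormGen.exists_of_append {σ : Type} {R : List (ℕ × BFGBody σ)}
    {s t : List (Symbol (FlatSymbol σ) ℕ)} {w : List (FlatSymbol σ)} (h : FormGen R (s ++ t) w) :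
    ∃ u v, w = u ++ v ∧ FormGen R s u ∧ FormGen R t v := by
  induction s generalizing w with
  | nil => exact ⟨[], w, rfl, .nil, h⟩
  | cons x s ih =>
    cases h with
    | terminal h =>
      obtain ⟨u, v, rfl, hu, hv⟩ := ih h
      exact ⟨_, v, rfl, .terminal hu, hv⟩
    | nonterminal h₁ h =>
      obtain ⟨u, v, rfl, hu, hv⟩ := ih h
      exact ⟨_, v, (List.append_assoc _ _ _).symm, .nonterminal h₁ hu, hv⟩

theorem FormGen.terminals {σ : Type} (R : List (ℕ × BFGBody σ)) (w : List (FlatSymbol σ)) :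
    FormGen R (w.map Symbol.terminal) w := by
  induction w with
  | nil => exact .nil
  | cons a w ih => exact .terminal ih

/-- A body of a production, as a sentential form, generates the trees which the production
allows at its root. -/
theorem FlatGen.of_formGen {σ : Type} {R : List (ℕ × BFGBody σ)} {N : ℕ} {b : BFGBody σ}
    {w : List (FlatSymbol σ)} (hb : (N, b) ∈ R) (h : FormGen R b.output w) : FlatGen R N w := by
  cases b with
  | letter t =>
    cases h with
    | terminal h => cases h; exact .letter hb
  | leaf =>
    cases h with
    | terminal h =>
      cases h with
      | terminal h => cases h; exact .leaf hb
  | node N₁ N₂ =>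
    cases h with
    | terminal h =>
      cases h with
      | nonterminal hu h =>
        cases h with
        | nonterminal hv h =>
          cases h with
          | terminal h =>
            cases h
            have := FlatGen.node hb hu hv
            simpa using this

theorem BFG.mem_toCFG_rules {σ : Type} [DecidableEq σ] (G : BFG σ)
    (r : ContextFreeRule (FlatSymbol σ) ℕ) :
    r ∈ G.toCFG.rules ↔ ∃ N b, (N, b) ∈ G.rules ∧ r = ⟨N, b.output⟩ := by
  unfold BFG.toCFG
  simp [eq_comm]

theorem FlatGen.derives {σ : Type} [DecidableEq σ] (G : BFG σ) {N : ℕ} {w : List (FlatSymbol σ)}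
    (h : FlatGen G.rules N w) : G.toCFG.Derives [.nonterminal N] (w.map .terminal) := by
  have hrule : ∀ {N : ℕ} {b : BFGBody σ}, (N, b) ∈ G.rules →
      G.toCFG.Derives [.nonterminal N] b.output := fun {N b} hb =>
    ContextFreeGrammar.Produces.single
      ⟨⟨N, b.output⟩, (G.mem_toCFG_rules _).2 ⟨N, b, hb, rfl⟩,
        ContextFreeRule.Rewrites.input_output⟩
  induction h with
  | letter h => exact hrule h
  | leaf h => exact hrule h
  | @node N N₁ N₂ u v h hu hv ihu ihv =>
    refine (hrule h).trans ?_
    have h₁ := (ihu.append_left [.terminal .opening]).append_right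
      [.nonterminal N₂, .terminal .closing]
    have h₂ := (ihv.append_left (.terminal .opening :: u.map .terminal)).append_right
      [.terminal .closing]
    refine ContextFreeGrammar.Derives.trans (v := Symbol.terminal .opening ::
      (u.map .terminal ++ [.nonterminal N₂, .terminal .closing])) ?_ ?_
    · exact h₁
    · rw [List.map_append, List.map_cons, List.map_append]
      simp only [List.append_assoc] at h₂ ⊢
      exact h₂

theorem FormGen.of_derives {σ : Type} [DecidableEq σ] (G : BFG σ)
    {s : List (Symbol (FlatSymbol σ) ℕ)} {w : List (FlatSymbol σ)}
    (h : G.toCFG.Derives s (w.map .terminal)) : FormGen G.rules s w := by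
  induction h using Relation.ReflTransGen.head_induction_on with
  | refl => exact .terminals _ w
  | head h _ ih =>
    obtain ⟨r, hr, h⟩ := h
    obtain ⟨p, q, rfl, rfl⟩ := h.exists_parts
    obtain ⟨N, b, hb, rfl⟩ := (G.mem_toCFG_rules r).1 hr
    obtain ⟨x, v₃, rfl, h₁, h₃⟩ := ih.exists_of_append
    obtain ⟨v₁, v₂, rfl, h₁, h₂⟩ := h₁.exists_of_append
    refine (h₁.append ?_).append h₃
    rw [← List.append_nil v₂]
    exact .nonterminal (.of_formGen hb h₂) .nil

/-- The language of a binary flattened tree grammar consists of the flattenings of the trees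
which it generates from its start symbol. -/
theorem BFG.mem_language_iff {σ : Type} [DecidableEq σ] (G : BFG σ) (w : List (FlatSymbol σ)) :
    w ∈ G.language ↔ FlatGen G.rules G.start w := by
  refine ⟨fun h => ?_, fun h => FlatGen.derives G h⟩
  have h' : FormGen G.rules [.nonterminal G.start] w := .of_derives G h
  generalize hx : w = x at h'
  cases h' with
  | nonterminal hu h =>
    cases h
    rwa [List.append_nil]

/-! ### Context-free grammars in binary form, and padding with blank trees -/

/-- Right-hand sides of productions of a context-free grammar in binary form without empty
productions: a letter, two nonterminals, or one nonterminal. -/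
inductive CFBody (ν α : Type) : Type
  | letter (a : α)
  | node (N₁ N₂ : ν)
  | unit (N' : ν)

/-- `Gen R N x`: the word `x` is generated from the nonterminal `N` by the productions `R`. -/
inductive Gen {ν α : Type} (R : List (ν × CFBody ν α)) : ν → List α → Prop
  | letter {N : ν} {a : α} (h : (N, .letter a) ∈ R) : Gen R N [a]
  | node {N N₁ N₂ : ν} {x y : List α} (h : (N, .node N₁ N₂) ∈ R) (hx : Gen R N₁ x)
      (hy : Gen R N₂ y) : Gen R N (x ++ y)
  | unit {N N' : ν} {x : List α} (h : (N, .unit N') ∈ R) (hx : Gen R N' x) : Gen R N x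

theorem Gen.ne_nil {ν α : Type} {R : List (ν × CFBody ν α)} {N : ν} {x : List α}
    (h : Gen R N x) : x ≠ [] := by
  induction h with
  | letter h => simp
  | node h hx hy ihx ihy => simp [ihx]
  | unit h hx ih => exact ih

theorem Gen.exists_rule {ν α : Type} {R : List (ν × CFBody ν α)} {N : ν} {x : List α}
    (h : Gen R N x) : ∃ b, (N, b) ∈ R := by
  cases h with
  | letter h => exact ⟨_, h⟩
  | node h => exact ⟨_, h⟩
  | unit h => exact ⟨_, h⟩

/-- The production of trees which stands for a production of words.  The nonterminal `0` is
reserved for the blank tree, which has a single node and carries no letter. -/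
def CFBody.toBFG {α : Type} : CFBody ℕ α → BFGBody α
  | .letter a => .letter a
  | .node N₁ N₂ => .node (N₁ + 1) (N₂ + 1)
  | .unit N' => .node 0 (N' + 1)

/-- The tree productions for the word production `r`: its own, together with those that put a
tree below a new root whose other child is blank. -/
def padRule {α : Type} (r : ℕ × CFBody ℕ α) : List (ℕ × BFGBody α) :=
  [(r.1 + 1, r.2.toBFG), (r.1 + 1, .node 0 (r.1 + 1)), (r.1 + 1, .node (r.1 + 1) 0)]

/-- The productions of a binary flattened tree grammar whose trees, once brackets are erased,
spell the words generated by `R`. -/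
def padRules {α : Type} (R : List (ℕ × CFBody ℕ α)) : List (ℕ × BFGBody α) :=
  (0, .leaf) :: R.flatMap padRule

theorem mem_padRules {α : Type} {R : List (ℕ × CFBody ℕ α)} {p : ℕ × BFGBody α} :
    p ∈ padRules R ↔ p = (0, .leaf) ∨ ∃ r ∈ R, p ∈ padRule r := by
  simp [padRules]

/-- The letters of a flattened tree, brackets erased. -/
def eraseBrackets {α : Type} (w : List (FlatSymbol α)) : List α :=
  w.flatMap fun s => match s with
    | .letter a => [a]
    | .opening => []
    | .closing => []

theorem eraseBrackets_append {α : Type} (u v : List (FlatSymbol α)) :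
    eraseBrackets (u ++ v) = eraseBrackets u ++ eraseBrackets v := List.flatMap_append

/-- Erasing the brackets of a padded tree leaves a generated word, or nothing for the blank tree,
which belongs to the nonterminal `0`. -/
theorem FlatGen.gen_eraseBrackets {α : Type} {R : List (ℕ × CFBody ℕ α)} {M : ℕ}
    {w : List (FlatSymbol α)} (h : FlatGen (padRules R) M w) :
    (M = 0 ∧ eraseBrackets w = []) ∨
      ∃ N, M = N + 1 ∧ Gen R N (eraseBrackets w) := by
  induction h with
  | @letter M t h =>
    obtain h | ⟨⟨N, b⟩, hr, h⟩ := mem_padRules.1 h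
    · simp at h
    · right
      cases b <;> simp [padRule, CFBody.toBFG] at h
      obtain ⟨rfl, rfl⟩ := h
      exact ⟨N, rfl, .letter hr⟩
  | @leaf M h =>
    obtain h | ⟨⟨N, b⟩, hr, h⟩ := mem_padRules.1 h
    · left
      exact ⟨(Prod.ext_iff.1 h).1, rfl⟩
    · cases b <;> simp [padRule, CFBody.toBFG] at h
  | @node M N₁ N₂ u v hR hu hv ihu ihv =>
    have hw : eraseBrackets (.opening :: u ++ v ++ [.closing]) =
        eraseBrackets u ++ eraseBrackets v := by
      rw [eraseBrackets_append, eraseBrackets_append]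
      simp [eraseBrackets]
    rw [hw]
    obtain h | ⟨⟨N, b⟩, hr, h⟩ := mem_padRules.1 hR
    · simp at h
    right
    have key : ∀ {n : ℕ} {z : List (FlatSymbol α)}, (n + 1 = 0 ∧ eraseBrackets z = []) ∨
        (∃ N, n + 1 = N + 1 ∧ Gen R N (eraseBrackets z)) →
          Gen R n (eraseBrackets z) := by
      rintro n z (⟨h, -⟩ | ⟨N, h, hN⟩)
      · omega
      · obtain rfl : n = N := by omega
        exact hN
    have key₀ : ∀ {z : List (FlatSymbol α)}, (0 = 0 ∧ eraseBrackets z = []) ∨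
        (∃ N, 0 = N + 1 ∧ Gen R N (eraseBrackets z)) → eraseBrackets z = [] := by
      rintro z (⟨-, h⟩ | ⟨N, h, -⟩)
      · exact h
      · omega
    simp only [padRule, List.mem_cons, List.not_mem_nil, or_false, Prod.mk.injEq] at h
    obtain ⟨rfl, h⟩ | ⟨rfl, h⟩ | ⟨rfl, h⟩ := h
    · refine ⟨N, rfl, ?_⟩
      cases b <;> simp only [CFBody.toBFG, reduceCtorEq, BFGBody.node.injEq] at h
      · obtain ⟨rfl, rfl⟩ := h
        exact .node hr (key ihu) (key ihv)
      · obtain ⟨rfl, rfl⟩ := h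
        rw [key₀ ihu]
        exact .unit hr (key ihv)
    · simp only [BFGBody.node.injEq] at h
      obtain ⟨rfl, rfl⟩ := h
      rw [key₀ ihu]
      exact ⟨N, rfl, key ihv⟩
    · simp only [BFGBody.node.injEq] at h
      obtain ⟨rfl, rfl⟩ := h
      rw [key₀ ihv, List.append_nil]
      exact ⟨N, rfl, key ihu⟩

/-- The product `t₁ V t₂ V ⋯ V tₙ`, where `tᵢ` is the value of `f` at the `i`-th letter. -/
def sepProd {α M : Type*} [Monoid M] (f : α → M) (V : M) : List α → M
  | [] => 1
  | [a] => f a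
  | a :: b :: x => f a * V * sepProd f V (b :: x)

theorem sepProd_append {α M : Type*} [Monoid M] (f : α → M) (V : M) {x y : List α} (hx : x ≠ [])
    (hy : y ≠ []) : sepProd f V (x ++ y) = sepProd f V x * V * sepProd f V y := by
  induction x with
  | nil => exact absurd rfl hx
  | cons a x ih =>
    cases x with
    | nil =>
      cases y with
      | nil => exact absurd rfl hy
      | cons b y => rfl
    | cons b x =>
      change f a * V * sepProd f V (b :: x ++ y) = f a * V * sepProd f V (b :: x) * V * _
      rw [ih (by simp)]
      simp only [mul_assoc]

/-- A finite automaton reading flattened trees cannot see their shape: there are `U`, `V`, `W`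
such that every generated word `t₁ ⋯ tₙ` has a tree on which the automaton acts as
`U t₁ V t₂ V ⋯ V tₙ W`. -/
theorem exists_flatGen_act {α σ : Type} [Finite σ] (M : DFA (FlatSymbol α) σ) :
    ∃ U V W : (Function.End σ)ᵐᵒᵖ, ∀ (R : List (ℕ × CFBody ℕ α)) (N : ℕ) (x : List α),
      Gen R N x → ∃ w, FlatGen (padRules R) (N + 1) w ∧
        M.act w = U * sepProd (fun a => M.act [.letter a]) V x * W := by
  -- A new root with a blank right child acts as `m ↦ o m (o c c)`, one with a blank left child
  -- as `m ↦ (o o c) m c`.  The combination `m ↦ A m B` of `s` roots of the first kind above one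
  -- of the second kind has the same right factor `B` as `s` roots of the first kind above an
  -- ordinary binary node; this allows the brackets of such a node to be absorbed.
  set o := M.act [.opening] with ho
  set c := M.act [.closing] with hc
  obtain ⟨s, hE⟩ := exists_isIdempotentElem_pow o
  set A := o ^ (s + 1) * (o * c) with hA
  set B := c * (o * c * c) ^ s with hB
  obtain ⟨p, hAp, hBp⟩ := exists_isIdempotentElem_pow₂ A B
  have hEA : o ^ (s + 1) * A = A := by rw [hA, ← mul_assoc, hE.eq]
  set U := A ^ (p + 1) with hU
  set W := B ^ (p + 1) with hW
  refine ⟨U, W * B * U, W, fun R N x hx => ?_⟩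
  have blank : FlatGen (padRules R) 0 [.opening, .closing] := .leaf (by simp [padRules])
  have act_node : ∀ u v : List (FlatSymbol α),
      M.act (.opening :: u ++ v ++ [.closing]) = o * M.act u * M.act v * c := by
    intro u v
    rw [DFA.act_append, DFA.act_append, DFA.act_cons]
  have act_blank : M.act [.opening, .closing] = o * c := M.act_append [.opening] [.closing]
  let Val : ℕ → (Function.End σ)ᵐᵒᵖ → Prop := fun N m =>
    ∃ w, FlatGen (padRules R) (N + 1) w ∧ M.act w = m
  have right : ∀ {N b m}, (N, b) ∈ R → Val N m → Val N (o * m * (o * c * c)) := by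
    rintro N b m hr ⟨w, hw, rfl⟩
    refine ⟨_, .node (mem_padRules.2 (.inr ⟨_, hr, ?_⟩)) hw blank, ?_⟩
    · simp [padRule]
    · rw [act_node, act_blank]
      simp only [mul_assoc]
  have left : ∀ {N b m}, (N, b) ∈ R → Val N m → Val N (o * (o * c) * m * c) := by
    rintro N b m hr ⟨w, hw, rfl⟩
    refine ⟨_, .node (mem_padRules.2 (.inr ⟨_, hr, ?_⟩)) blank hw, ?_⟩
    · simp [padRule]
    · rw [act_node, act_blank]
  have right_pow : ∀ {N b m}, (N, b) ∈ R → Val N m → ∀ k,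
      Val N (o ^ k * m * (o * c * c) ^ k) := by
    intro N b m hr hm k
    induction k with
    | zero => simpa using hm
    | succ k ih =>
      have := right hr ih
      rw [pow_succ', pow_succ (o * c * c)]
      simpa only [mul_assoc] using this
  have both : ∀ {N b m}, (N, b) ∈ R → Val N m → Val N (A * m * B) := by
    intro N b m hr hm
    have := right_pow hr (left hr hm) s
    rw [hA, hB, pow_succ]
    simpa only [mul_assoc] using this
  have both_pow : ∀ {N b m}, (N, b) ∈ R → Val N m → ∀ k, Val N (A ^ k * m * B ^ k) := by
    intro N b m hr hm k
    induction k with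
    | zero => simpa using hm
    | succ k ih =>
      have := both hr ih
      rw [pow_succ', pow_succ B]
      simpa only [mul_assoc] using this
  have hAU : A ^ p * (A * U) = U := by rw [← mul_assoc, ← pow_succ, ← hU, hAp.eq]
  have hWB : W * (B * B ^ p) = W := by rw [← pow_succ', ← hW, hBp.eq]
  have hAU' : A ^ p * (o ^ (s + 1) * (o * c) * U) = U := hAU
  have hWB' : W * (c * (o * c * c) ^ s * B ^ p) = W := hWB
  change Val N _
  induction hx with
  | @letter N a h =>
    exact both_pow h ⟨_, .letter (mem_padRules.2 (.inr ⟨_, h, by simp [padRule, CFBody.toBFG]⟩)),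
      rfl⟩ (p + 1)
  | @node N N₁ N₂ x y h hx hy ihx ihy =>
    obtain ⟨b₁, h₁⟩ := hx.exists_rule
    obtain ⟨u, hu, hu'⟩ := both h₁ ihx
    obtain ⟨v, hv, hv'⟩ := ihy
    have hnode : Val N (M.act (.opening :: u ++ v ++ [.closing])) :=
      ⟨_, .node (mem_padRules.2 (.inr ⟨_, h, by simp [padRule, CFBody.toBFG]⟩)) hu hv, rfl⟩
    have := both_pow h (right_pow h hnode s) p
    rw [act_node, hu', hv'] at this
    rw [sepProd_append _ _ hx.ne_nil hy.ne_nil]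
    convert this using 1
    generalize sepProd (fun a => M.act [.letter a]) (W * B * U) x = X
    generalize sepProd (fun a => M.act [.letter a]) (W * B * U) y = Y
    calc U * (X * (W * B * U) * Y) * W
        = A ^ p * (o ^ (s + 1) * A * U) * (X * (W * B * U) * Y) *
          (W * (c * (o * c * c) ^ s * B ^ p)) := by rw [hEA, hAU, hWB']
      _ = _ := by
        rw [pow_succ]
        simp only [mul_assoc]
  | @unit N N' x h hx ih =>
    obtain ⟨v, hv, hv'⟩ := ih
    have hnode : Val N (M.act (.opening :: [.opening, .closing] ++ v ++ [.closing])) :=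
      ⟨_, .node (mem_padRules.2 (.inr ⟨_, h, by simp [padRule, CFBody.toBFG]⟩)) blank hv, rfl⟩
    have := both_pow h (right_pow h hnode s) p
    rw [act_node, act_blank, hv'] at this
    convert this using 1
    generalize sepProd (fun a => M.act [.letter a]) (W * B * U) x = X
    calc U * X * W
        = A ^ p * (o ^ (s + 1) * (o * c) * U) * X * (W * (c * (o * c * c) ^ s * B ^ p)) := by
          rw [hAU', hWB']
      _ = _ := by
        rw [pow_succ]
        simp only [mul_assoc]

/-- The words `t₁ ⋯ tₙ` for which `U t₁ V t₂ V ⋯ V tₙ W` leads an automaton to acceptance form a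
regular language. -/
theorem isRegular_sepProd {α β σ : Type} [Finite σ] (M : DFA β σ) (f : α → β)
    (U V W : (Function.End σ)ᵐᵒᵖ) :
    Language.IsRegular ({x | x ≠ [] ∧
      (U * sepProd (fun a => M.act [f a]) V x * W).unop M.start ∈ M.accept} : Language α) := by
  have := Fintype.ofFinite σ
  -- The state `none` is left with the first letter, which is preceded by `U` instead of `V`.
  let D : DFA α (Option σ) :=
    { step := fun s a => match s with
        | none => some ((U * M.act [f a]).unop M.start)
        | some s => some ((V * M.act [f a]).unop s)
      start := none
      accept := {s | ∃ t, s = some t ∧ W.unop t ∈ M.accept} }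
  have hD : ∀ x, x ≠ [] →
      D.eval x = some ((U * sepProd (fun a => M.act [f a]) V x).unop M.start) := by
    intro x
    induction x using List.reverseRecOn with
    | nil => exact fun h => absurd rfl h
    | append_singleton x a ih =>
      intro _
      rw [DFA.eval_append_singleton]
      by_cases hx : x = []
      · subst hx
        rfl
      · rw [ih hx, sepProd_append _ _ hx (by simp), ← mul_assoc, ← mul_assoc]
        rw [mul_assoc _ V]
        rfl
  refine ⟨_, inferInstance, D, ?_⟩
  ext x
  rw [DFA.mem_accepts]
  change (∃ t, D.eval x = some t ∧ W.unop t ∈ M.accept) ↔ x ≠ [] ∧ _ ∈ M.accept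
  by_cases hx : x = []
  · subst hx
    simp [D]
  · rw [hD x hx]
    simp only [Option.some.injEq, exists_eq_left', ne_eq, hx, not_false_eq_true, true_and]
    rfl

theorem gen_of_mem_padRules {α : Type} [DecidableEq α] {R : List (ℕ × CFBody ℕ α)} {N : ℕ}
    {w : List (FlatSymbol α)} (hw : w ∈ BFG.language ⟨N + 1, padRules R⟩) :
    Gen R N (eraseBrackets w) := by
  obtain ⟨h, -⟩ | ⟨N', h, h'⟩ := ((BFG.mem_language_iff _ _).1 hw).gen_eraseBrackets
  · exact absurd h N.succ_ne_zero
  · obtain rfl := Nat.succ_injective h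
    exact h'

/-- Two padded grammars are separable exactly if the word grammars are: brackets do not help a
finite automaton. -/
theorem regularSeparable_padRules_iff {α : Type} [DecidableEq α] (R : List (ℕ × CFBody ℕ α))
    (N₁ N₂ : ℕ) :
    RegularSeparable (BFG.language ⟨N₁ + 1, padRules R⟩) (BFG.language ⟨N₂ + 1, padRules R⟩) ↔
      RegularSeparable ({x | Gen R N₁ x} : Language α) ({x | Gen R N₂ x} : Language α) := by
  constructor
  · rintro ⟨_, ⟨σ, _, M, rfl⟩, h₁, h₂⟩
    obtain ⟨U, V, W, hUVW⟩ := exists_flatGen_act M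
    refine ⟨_, isRegular_sepProd M FlatSymbol.letter U V W, fun x hx => ?_, fun x hx hx' => ?_⟩
    · obtain ⟨w, hw, hw'⟩ := hUVW R N₁ x hx
      refine ⟨hx.ne_nil, ?_⟩
      rw [← hw']
      exact h₁ w ((BFG.mem_language_iff _ _).2 hw)
    · obtain ⟨w, hw, hw'⟩ := hUVW R N₂ x hx
      refine h₂ w ((BFG.mem_language_iff _ _).2 hw) ?_
      have := hx'.2
      rw [← hw'] at this
      exact this
  · rintro ⟨_, ⟨σ, _, M, rfl⟩, h₁, h₂⟩
    let D : DFA (FlatSymbol α) σ :=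
      { step := fun s a => M.evalFrom s (eraseBrackets [a])
        start := M.start
        accept := M.accept }
    have hD : ∀ w, D.eval w = M.eval (eraseBrackets w) := by
      intro w
      induction w using List.reverseRecOn with
      | nil => rfl
      | append_singleton w a ih =>
        rw [DFA.eval_append_singleton, eraseBrackets_append, ih]
        exact (M.evalFrom_of_append _ _ _).symm
    refine ⟨D.accepts, ⟨σ, inferInstance, D, rfl⟩, fun w hw => ?_, fun w hw hw' => ?_⟩
    · rw [DFA.mem_accepts, hD]
      exact h₁ _ (gen_of_mem_padRules hw)
    · rw [DFA.mem_accepts, hD] at hw'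
      exact h₂ _ (gen_of_mem_padRules hw) hw'

theorem disjoint_padRules {α : Type} [DecidableEq α] (R : List (ℕ × CFBody ℕ α)) (N₁ N₂ : ℕ)
    (h : ∀ x, Gen R N₁ x → ¬ Gen R N₂ x) :
    Disjoint (BFG.language ⟨N₁ + 1, padRules R⟩) (BFG.language ⟨N₂ + 1, padRules R⟩) := by
  exact Set.disjoint_left.2 fun w h₁ h₂ => h _ (gen_of_mem_padRules h₁) (gen_of_mem_padRules h₂)

/-! ### Expressions for context-free languages -/

/-- The words that a right-hand side yields when its nonterminals stand for the languages `S`. -/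
def CFBody.Yields {ν α : Type} (S : ν → List α → Prop) : CFBody ν α → List α → Prop
  | .letter a, w => w = [a]
  | .node N₁ N₂, w => ∃ x y, S N₁ x ∧ S N₂ y ∧ w = x ++ y
  | .unit N', w => S N' w

/-- The generated languages are contained in every family of languages which is closed under the
productions. -/
theorem Gen.of_closed {ν α : Type} {R : List (ν × CFBody ν α)} {S : ν → List α → Prop}
    (hS : ∀ N b w, (N, b) ∈ R → b.Yields S w → S N w) {N : ν} {w : List α} (h : Gen R N w) :
    S N w := by
  induction h with
  | letter h => exact hS _ _ _ h rfl
  | node h _ _ ihx ihy => exact hS _ _ _ h ⟨_, _, ihx, ihy, rfl⟩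
  | unit h _ ih => exact hS _ _ _ h ih

/-- Renaming of nonterminals and letters in a right-hand side. -/
def CFBody.map {ν μ α β : Type} (f : ν → μ) (g : α → β) : CFBody ν α → CFBody μ β
  | .letter a => .letter (g a)
  | .node N₁ N₂ => .node (f N₁) (f N₂)
  | .unit N' => .unit (f N')

/-- Renaming of nonterminals and letters in a list of productions. -/
def mapRules {ν μ α β : Type} (f : ν → μ) (g : α → β) (R : List (ν × CFBody ν α)) :
    List (μ × CFBody μ β) :=
  R.map fun r => (f r.1, r.2.map f g)

theorem gen_mapRules_iff {ν μ α β : Type} {f : ν → μ} (hf : Function.Injective f) (g : α → β)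
    (R : List (ν × CFBody ν α)) (N : ν) (w : List β) :
    Gen (mapRules f g R) (f N) w ↔ ∃ x, Gen R N x ∧ w = x.map g := by
  have hmem : ∀ {N b}, (N, b) ∈ R → (f N, b.map f g) ∈ mapRules f g R := fun {N b} h =>
    List.mem_map.2 ⟨(N, b), h, rfl⟩
  constructor
  · intro h
    have := Gen.of_closed (S := fun M w => ∀ N, M = f N → ∃ x, Gen R N x ∧ w = x.map g) ?_ h
    · exact this N rfl
    · rintro M b' w hb' hw N rfl
      obtain ⟨⟨N', b⟩, hb, h⟩ := List.mem_map.1 hb'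
      simp only [Prod.mk.injEq] at h
      obtain ⟨h, rfl⟩ := h
      obtain rfl := hf h
      cases b with
      | letter a => exact ⟨[a], .letter hb, hw⟩
      | node N₁ N₂ =>
        obtain ⟨_, _, hu, hv, rfl⟩ := hw
        obtain ⟨x, hx, rfl⟩ := hu _ rfl
        obtain ⟨y, hy, rfl⟩ := hv _ rfl
        exact ⟨x ++ y, .node hb hx hy, List.map_append.symm⟩
      | unit N'' =>
        obtain ⟨x, hx, rfl⟩ := hw _ rfl
        exact ⟨x, .unit hb hx, rfl⟩
  · rintro ⟨x, hx, rfl⟩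
    induction hx with
    | letter h => exact .letter (hmem h)
    | node h _ _ ihx ihy => rw [List.map_append]; exact .node (hmem h) ihx ihy
    | unit h _ ih => exact .unit (hmem h) ih

/-- Expressions for context-free languages without the empty word.  `lin A C B` stands for the
union of all `Aⁿ C Bⁿ`, `star A C` for `A* C`, and `mirror S C` for the words `s c sʳ`, where `s`
is a word over the letters in the list `S`, `sʳ` its reversal, and `c` belongs to `C`. -/
inductive CFExpr (α : Type) : Type
  | empty
  | letter (a : α)
  | union (A B : CFExpr α)
  | concat (A B : CFExpr α)
  | lin (A C B : CFExpr α)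
  | star (A C : CFExpr α)
  | mirror (S : List α) (C : CFExpr α)
  deriving Encodable

/-- The least language which contains `C` and is closed under `x ↦ a x b` for `a` in `A` and `b`
in `B`. -/
inductive LinClosure {α : Type} (A C B : List α → Prop) : List α → Prop
  | base {x : List α} (h : C x) : LinClosure A C B x
  | step {a x b : List α} (ha : A a) (hx : LinClosure A C B x) (hb : B b) :
      LinClosure A C B (a ++ (x ++ b))

/-- The least language which contains `C` and is closed under `x ↦ a x` for `a` in `A`. -/
inductive StarClosure {α : Type} (A C : List α → Prop) : List α → Prop
  | base {x : List α} (h : C x) : StarClosure A C x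
  | step {a x : List α} (ha : A a) (hx : StarClosure A C x) : StarClosure A C (a ++ x)

/-- The language of an expression. -/
def CFExpr.Mem {α : Type} : CFExpr α → List α → Prop
  | .empty, _ => False
  | .letter a, w => w = [a]
  | .union A B, w => A.Mem w ∨ B.Mem w
  | .concat A B, w => ∃ x y, A.Mem x ∧ B.Mem y ∧ w = x ++ y
  | .lin A C B, w => LinClosure A.Mem C.Mem B.Mem w
  | .star A C, w => StarClosure A.Mem C.Mem w
  | .mirror S C, w => ∃ s x, (∀ a ∈ s, a ∈ S) ∧ C.Mem x ∧ w = s ++ x ++ s.reverse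

/-- Productions for the language of an expression; the nonterminals are expressions. -/
def CFExpr.rules {α : Type} : CFExpr α → List (CFExpr α × CFBody (CFExpr α) α)
  | .empty => []
  | .letter a => [(.letter a, .letter a)]
  | .union A B => (.union A B, .unit A) :: (.union A B, .unit B) :: (A.rules ++ B.rules)
  | .concat A B => (.concat A B, .node A B) :: (A.rules ++ B.rules)
  | .lin A C B =>
      (.lin A C B, .unit C) :: (.lin A C B, .node A (.concat (.lin A C B) B)) ::
        (.concat (.lin A C B) B, .node (.lin A C B) B) :: (A.rules ++ (B.rules ++ C.rules))
  | .star A C =>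
      (.star A C, .unit C) :: (.star A C, .node A (.star A C)) :: (A.rules ++ C.rules)
  | .mirror S C =>
      (.mirror S C, .unit C) :: (C.rules ++ S.flatMap fun a =>
        [(.mirror S C, .node (.letter a) (.concat (.mirror S C) (.letter a))),
          (.concat (.mirror S C) (.letter a), .node (.mirror S C) (.letter a)),
          (.letter a, .letter a)])

theorem CFExpr.mem_of_yields {α : Type} (e : CFExpr α) :
    ∀ N b w, (N, b) ∈ e.rules → b.Yields CFExpr.Mem w → N.Mem w := by
  induction e with
  | empty => intro N b w h; simp [CFExpr.rules] at h
  | letter a =>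
    intro N b w h hw
    simp only [CFExpr.rules, List.mem_singleton, Prod.mk.injEq] at h
    obtain ⟨rfl, rfl⟩ := h
    exact hw
  | union A B ihA ihB =>
    intro N b w h hw
    simp only [CFExpr.rules, List.mem_cons, List.mem_append, Prod.mk.injEq] at h
    obtain ⟨rfl, rfl⟩ | ⟨rfl, rfl⟩ | h | h := h
    · exact .inl hw
    · exact .inr hw
    · exact ihA _ _ _ h hw
    · exact ihB _ _ _ h hw
  | concat A B ihA ihB =>
    intro N b w h hw
    simp only [CFExpr.rules, List.mem_cons, List.mem_append, Prod.mk.injEq] at h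
    obtain ⟨rfl, rfl⟩ | h | h := h
    · exact hw
    · exact ihA _ _ _ h hw
    · exact ihB _ _ _ h hw
  | lin A C B ihA ihC ihB =>
    intro N b w h hw
    simp only [CFExpr.rules, List.mem_cons, List.mem_append, Prod.mk.injEq] at h
    obtain ⟨rfl, rfl⟩ | ⟨rfl, rfl⟩ | ⟨rfl, rfl⟩ | h | h | h := h
    · exact .base hw
    · obtain ⟨a, _, ha, ⟨x, b, hx, hb, rfl⟩, rfl⟩ := hw
      exact .step ha hx hb
    · exact hw
    · exact ihA _ _ _ h hw
    · exact ihB _ _ _ h hw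
    · exact ihC _ _ _ h hw
  | star A C ihA ihC =>
    intro N b w h hw
    simp only [CFExpr.rules, List.mem_cons, List.mem_append, Prod.mk.injEq] at h
    obtain ⟨rfl, rfl⟩ | ⟨rfl, rfl⟩ | h | h := h
    · exact .base hw
    · obtain ⟨a, x, ha, hx, rfl⟩ := hw
      exact .step ha hx
    · exact ihA _ _ _ h hw
    · exact ihC _ _ _ h hw
  | mirror S C ihC =>
    intro N b w h hw
    simp only [CFExpr.rules, List.mem_cons, List.mem_append, List.mem_flatMap, Prod.mk.injEq,
      List.not_mem_nil, or_false] at h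
    obtain ⟨rfl, rfl⟩ | h | ⟨a, ha, ⟨rfl, rfl⟩ | ⟨rfl, rfl⟩ | ⟨rfl, rfl⟩⟩ := h
    · exact ⟨[], w, by simp, hw, by simp⟩
    · exact ihC _ _ _ h hw
    · obtain ⟨_, _, rfl, ⟨_, _, ⟨s, x, hs, hx, rfl⟩, rfl, rfl⟩, rfl⟩ := hw
      refine ⟨a :: s, x, ?_, hx, by simp⟩
      simpa [ha] using hs
    · exact hw
    · exact hw

theorem CFExpr.gen_of_mem {α : Type} {R : List (CFExpr α × CFBody (CFExpr α) α)} (e : CFExpr α) :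
    e.rules ⊆ R → ∀ w, e.Mem w → Gen R e w := by
  induction e with
  | empty => exact fun _ w h => h.elim
  | letter a =>
    rintro hR _ rfl
    exact .letter (hR (by simp [CFExpr.rules]))
  | union A B ihA ihB =>
    intro hR w hw
    simp only [CFExpr.rules, List.cons_subset, List.append_subset] at hR
    obtain ⟨h₁, h₂, hA, hB⟩ := hR
    obtain hw | hw := hw
    · exact .unit h₁ (ihA hA _ hw)
    · exact .unit h₂ (ihB hB _ hw)
  | concat A B ihA ihB =>
    rintro hR _ ⟨x, y, hx, hy, rfl⟩
    simp only [CFExpr.rules, List.cons_subset, List.append_subset] at hR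
    exact .node hR.1 (ihA hR.2.1 _ hx) (ihB hR.2.2 _ hy)
  | lin A C B ihA ihC ihB =>
    intro hR w hw
    simp only [CFExpr.rules, List.cons_subset, List.append_subset] at hR
    obtain ⟨h₁, h₂, h₃, hA, hB, hC⟩ := hR
    induction hw with
    | base h => exact .unit h₁ (ihC hC _ h)
    | step ha _ hb ih => exact .node h₂ (ihA hA _ ha) (.node h₃ ih (ihB hB _ hb))
  | star A C ihA ihC =>
    intro hR w hw
    simp only [CFExpr.rules, List.cons_subset, List.append_subset] at hR
    obtain ⟨h₁, h₂, hA, hC⟩ := hR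
    induction hw with
    | base h => exact .unit h₁ (ihC hC _ h)
    | step ha _ ih => exact .node h₂ (ihA hA _ ha) ih
  | mirror S C ihC =>
    rintro hR _ ⟨s, x, hs, hx, rfl⟩
    simp only [CFExpr.rules, List.cons_subset, List.append_subset] at hR
    obtain ⟨h₁, hC, hS⟩ := hR
    induction s with
    | nil => simpa using Gen.unit h₁ (ihC hC _ hx)
    | cons a s ih =>
      have ha := hs a (by simp)
      have hmem : ∀ r ∈ [(CFExpr.mirror S C, CFBody.node (.letter a)
            (CFExpr.concat (.mirror S C) (.letter a))),
          (.concat (.mirror S C) (.letter a), .node (.mirror S C) (.letter a)),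
          (.letter a, .letter a)], r ∈ R :=
        fun r hr => hS (List.mem_flatMap.2 ⟨a, ha, hr⟩)
      simp only [List.mem_cons, List.not_mem_nil, or_false, forall_eq_or_imp, forall_eq] at hmem
      have := Gen.node hmem.1 (.letter hmem.2.2)
        (.node hmem.2.1 (ih fun b hb => hs b (by simp [hb])) (.letter hmem.2.2))
      simpa using this

/-- Productions which put the word `x` in front of the words of `e`; the number `i` stands for
the nonterminal which generates the last `i` letters of `x` followed by a word of `e`. -/
def prependRules {α : Type} (e : CFExpr α) :
    List α → List ((CFExpr α ⊕ ℕ) × CFBody (CFExpr α ⊕ ℕ) α)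
  | [] => [(.inr 0, .unit (.inl e))]
  | a :: x => (.inr (x.length + 1), .node (.inl (.letter a)) (.inr x.length)) ::
      (.inl (.letter a), .letter a) :: prependRules e x

/-- Productions for the languages of `x · e₁` and `e₂`. -/
def pairRules {α : Type} (e₁ e₂ : CFExpr α) (x : List α) :
    List ((CFExpr α ⊕ ℕ) × CFBody (CFExpr α ⊕ ℕ) α) :=
  mapRules .inl id (e₁.rules ++ e₂.rules) ++ prependRules e₁ x

theorem prependRules_closed {α : Type} (e : CFExpr α) (z x : List α) (hx : x <:+ z)
    {S : CFExpr α ⊕ ℕ → List α → Prop} (hl : ∀ e, S (.inl e) = e.Mem)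
    (hr : ∀ i, S (.inr i) = fun w => ∃ y, e.Mem y ∧ w = z.drop (z.length - i) ++ y) :
    ∀ N b w, (N, b) ∈ prependRules e x → b.Yields S w → S N w := by
  induction x with
  | nil =>
    intro N b w h hw
    simp only [prependRules, List.mem_singleton, Prod.mk.injEq] at h
    obtain ⟨rfl, rfl⟩ := h
    rw [hr]
    change S (.inl e) w at hw
    rw [hl] at hw
    exact ⟨w, hw, by simp⟩
  | cons a x ih =>
    have ih := ih ((List.suffix_cons a x).trans hx)
    intro N b w h hw
    simp only [prependRules, List.mem_cons, Prod.mk.injEq] at h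
    obtain ⟨rfl, rfl⟩ | ⟨rfl, rfl⟩ | h := h
    · obtain ⟨_, _, h₁, h₂, rfl⟩ := hw
      rw [hl] at h₁
      rw [hr] at h₂ ⊢
      obtain rfl := h₁
      obtain ⟨y, hy, rfl⟩ := h₂
      refine ⟨y, hy, ?_⟩
      obtain ⟨t, rfl⟩ := hx
      rw [show (t ++ a :: x).length - (x.length + 1) = t.length by simp,
        show (t ++ a :: x).length - x.length = t.length + 1 by simp; omega]
      simp [List.drop_append]
    · rw [hl]
      exact hw
    · exact ih _ _ _ h hw

theorem gen_prependRules {α : Type} {e : CFExpr α} {x y : List α}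
    {R : List ((CFExpr α ⊕ ℕ) × CFBody (CFExpr α ⊕ ℕ) α)} (hR : prependRules e x ⊆ R)
    (hy : Gen R (.inl e) y) : Gen R (.inr x.length) (x ++ y) := by
  induction x with
  | nil => exact .unit (hR (by simp [prependRules])) hy
  | cons a x ih =>
    simp only [prependRules, List.cons_subset] at hR
    exact Gen.node (x := [a]) hR.1 (.letter hR.2.1) (ih hR.2.2)

theorem pairRules_closed {α : Type} (e₁ e₂ : CFExpr α) (x : List α)
    {N : CFExpr α ⊕ ℕ} {w : List α} (h : Gen (pairRules e₁ e₂ x) N w) :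
    Sum.elim CFExpr.Mem (fun i w => ∃ y, e₁.Mem y ∧ w = x.drop (x.length - i) ++ y) N w := by
  refine Gen.of_closed (fun N b w hb' hw => ?_) h
  obtain hb' | hb := List.mem_append.1 hb'
  · obtain ⟨⟨N', b'⟩, hb, h⟩ := List.mem_map.1 hb'
    simp only [Prod.mk.injEq] at h
    obtain ⟨rfl, rfl⟩ := h
    have hw' : b'.Yields CFExpr.Mem w := by cases b' <;> exact hw
    obtain hb | hb := List.mem_append.1 hb
    · exact CFExpr.mem_of_yields e₁ _ _ _ hb hw'
    · exact CFExpr.mem_of_yields e₂ _ _ _ hb hw'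
  · exact prependRules_closed e₁ x x List.suffix_rfl (fun _ => rfl) (fun _ => rfl) _ _ _ hb hw

theorem gen_pairRules_inl {α : Type} (e₁ e₂ : CFExpr α) (x : List α) {e : CFExpr α}
    (he : e = e₁ ∨ e = e₂) {w : List α} : Gen (pairRules e₁ e₂ x) (.inl e) w ↔ e.Mem w := by
  refine ⟨pairRules_closed e₁ e₂ x, fun h => ?_⟩
  have h₁ : Gen (e₁.rules ++ e₂.rules) e w := by
    refine CFExpr.gen_of_mem e (fun r hr => ?_) w h
    obtain rfl | rfl := he
    · exact List.mem_append_left _ hr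
    · exact List.mem_append_right _ hr
  have h₂ := (gen_mapRules_iff (Sum.inl_injective (β := ℕ)) id _ e w).2 ⟨w, h₁, by simp⟩
  refine Gen.of_closed (S := fun N w => Gen (pairRules e₁ e₂ x) N w) (fun N b w hb hw => ?_) h₂
  have hb : (N, b) ∈ pairRules e₁ e₂ x := List.mem_append_left _ hb
  cases b with
  | letter a => obtain rfl := hw; exact .letter hb
  | node N₁ N₂ => obtain ⟨_, _, h₁, h₂, rfl⟩ := hw; exact .node hb h₁ h₂
  | unit N' => exact .unit hb hw

theorem gen_pairRules_inr {α : Type} (e₁ e₂ : CFExpr α) (x : List α) {w : List α} :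
    Gen (pairRules e₁ e₂ x) (.inr x.length) w ↔ ∃ y, e₁.Mem y ∧ w = x ++ y := by
  refine ⟨fun h => by simpa using pairRules_closed e₁ e₂ x h, ?_⟩
  rintro ⟨y, hy, rfl⟩
  exact gen_prependRules (List.subset_append_right _ _)
    ((gen_pairRules_inl e₁ e₂ x (.inl rfl)).2 hy)

/-- A finite union. -/
def CFExpr.unions {α : Type} (l : List (CFExpr α)) : CFExpr α :=
  l.foldr .union .empty

theorem CFExpr.mem_unions {α : Type} {l : List (CFExpr α)} {w : List α} :
    (CFExpr.unions l).Mem w ↔ ∃ e ∈ l, e.Mem w := by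
  induction l with
  | nil => simp [unions, Mem]
  | cons e l ih =>
    rw [List.exists_mem_cons_iff, ← ih]
    rfl

/-- The words `x y z` with `y` in the language of `e`. -/
def CFExpr.surround {α : Type} (x : List α) (e : CFExpr α) (z : List α) : CFExpr α :=
  x.foldr (fun a f => .concat (.letter a) f)
    (z.foldl (fun f a => .concat f (.letter a)) e)

theorem CFExpr.mem_surround {α : Type} {x z : List α} {e : CFExpr α} {w : List α} :
    (CFExpr.surround x e z).Mem w ↔ ∃ y, e.Mem y ∧ w = x ++ y ++ z := by
  have hz : ∀ (z : List α) (e : CFExpr α) (w : List α),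
      (z.foldl (fun f a => CFExpr.concat f (.letter a)) e).Mem w ↔
        ∃ y, e.Mem y ∧ w = y ++ z := by
    intro z
    induction z with
    | nil => intro e w; simp
    | cons a z ih =>
      intro e w
      rw [List.foldl_cons, ih]
      simp only [Mem]
      constructor
      · rintro ⟨_, ⟨y, _, hy, rfl, rfl⟩, rfl⟩
        exact ⟨y, hy, by simp⟩
      · rintro ⟨y, hy, rfl⟩
        exact ⟨_, ⟨y, _, hy, rfl, rfl⟩, by simp⟩
  induction x generalizing w with
  | nil => simp [surround, hz]
  | cons a x ih =>
    change (∃ u v, u = [a] ∧ (CFExpr.surround x e z).Mem v ∧ w = u ++ v) ↔ _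
    simp only [ih]
    constructor
    · rintro ⟨_, _, rfl, ⟨y, hy, rfl⟩, rfl⟩
      exact ⟨y, hy, by simp⟩
    · rintro ⟨y, hy, rfl⟩
      exact ⟨_, _, rfl, ⟨y, hy, rfl⟩, by simp⟩

/-! ### Languages of computations -/

/-- Symbols for sequences of configurations: the letters of configurations, a separator, an end
marker, and a symbol used for counting. -/
inductive ChainSymbol (γ : Type) : Type
  | letter (a : γ)
  | sep
  | finish
  | tick
  deriving Fintype

/-- A configuration as a word over the symbols for sequences of configurations. -/
def block {γ : Type} (x : List γ) : List (ChainSymbol γ) :=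
  x.map .letter

/-- `BackwardChain r i w`: for some `m`, the word `w` consists of `m` pairs of a reversed
configuration and an `r`-successor of it, the end marker, and `m + i` ticks. -/
inductive BackwardChain {γ : Type} (r : List γ → List γ → Prop) :
    ℕ → List (ChainSymbol γ) → Prop
  | base (i : ℕ) : BackwardChain r i (.finish :: List.replicate i .tick)
  | step {i : ℕ} {x y : List γ} {w : List (ChainSymbol γ)} (h : r x y)
      (hw : BackwardChain r (i + 1) w) :
      BackwardChain r i (block x.reverse ++ .sep :: (block y ++ .sep :: w))

/-- `ForwardChain r i w`: for some `m`, the word `w` consists of `m` pairs of a configuration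
and a reversed `r`-successor of it, one more configuration, the end marker, and more than `m + i`
ticks. -/
inductive ForwardChain {γ : Type} (r : List γ → List γ → Prop) :
    ℕ → List (ChainSymbol γ) → Prop
  | base {i j : ℕ} (x : List γ) (h : i < j) :
      ForwardChain r i (block x ++ .sep :: .finish :: List.replicate j .tick)
  | step {i : ℕ} {x y : List γ} {w : List (ChainSymbol γ)} (h : r x y)
      (hw : ForwardChain r (i + 1) w) :
      ForwardChain r i (block x ++ .sep :: (block y.reverse ++ .sep :: w))

theorem block_append_sep_inj {γ : Type} {x y : List γ} {u v : List (ChainSymbol γ)}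
    (h : block x ++ .sep :: u = block y ++ .sep :: v) : x = y ∧ u = v := by
  induction x generalizing y with
  | nil =>
    cases y with
    | nil => simpa [block] using h
    | cons b y => simp [block] at h
  | cons a x ih =>
    cases y with
    | nil => simp [block] at h
    | cons b y =>
      simp only [block, List.map_cons, List.cons_append, List.cons.injEq,
        ChainSymbol.letter.injEq] at h
      obtain ⟨rfl, h⟩ := h
      obtain ⟨rfl, rfl⟩ := ih h
      exact ⟨rfl, rfl⟩

/-! ### Chains of different kind differ in the number of ticks -/

/-- Whether a symbol is the separator. -/
def ChainSymbol.isSep {γ : Type} : ChainSymbol γ → Bool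
  | .sep => true
  | _ => false

/-- Whether a symbol is a tick. -/
def ChainSymbol.isTick {γ : Type} : ChainSymbol γ → Bool
  | .tick => true
  | _ => false

theorem countP_isSep_block {γ : Type} (x : List γ) : (block x).countP ChainSymbol.isSep = 0 := by
  rw [List.countP_eq_zero]
  simp [block, ChainSymbol.isSep]

theorem countP_isTick_block {γ : Type} (x : List γ) :
    (block x).countP ChainSymbol.isTick = 0 := by
  rw [List.countP_eq_zero]
  simp [block, ChainSymbol.isTick]

theorem countP_isSep_replicate {γ : Type} (i : ℕ) :
    (List.replicate i (ChainSymbol.tick : ChainSymbol γ)).countP ChainSymbol.isSep = 0 := by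
  rw [List.countP_eq_zero]
  simp +contextual [ChainSymbol.isSep, List.mem_replicate]

theorem countP_isTick_replicate {γ : Type} (i : ℕ) :
    (List.replicate i (ChainSymbol.tick : ChainSymbol γ)).countP ChainSymbol.isTick = i := by
  simp [List.countP_replicate, ChainSymbol.isTick]

theorem BackwardChain.countP {γ : Type} {r : List γ → List γ → Prop} {i : ℕ}
    {w : List (ChainSymbol γ)} (h : BackwardChain r i w) :
    2 * w.countP ChainSymbol.isTick = w.countP ChainSymbol.isSep + 2 * i := by
  induction h with
  | base i =>
    simp only [List.countP_cons, countP_isSep_replicate, countP_isTick_replicate]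
    simp [ChainSymbol.isTick, ChainSymbol.isSep]
  | step h hw ih =>
    simp only [List.countP_append, List.countP_cons, countP_isSep_block, countP_isTick_block]
    simp [ChainSymbol.isTick, ChainSymbol.isSep]
    omega

theorem ForwardChain.countP {γ : Type} {r : List γ → List γ → Prop} {i : ℕ}
    {w : List (ChainSymbol γ)} (h : ForwardChain r i w) :
    w.countP ChainSymbol.isSep + 2 * i + 1 ≤ 2 * w.countP ChainSymbol.isTick := by
  induction h with
  | base x h =>
    simp only [List.countP_append, List.countP_cons, countP_isSep_replicate,
      countP_isTick_replicate, countP_isSep_block, countP_isTick_block]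
    simp [ChainSymbol.isTick, ChainSymbol.isSep]
    omega
  | step h hw ih =>
    simp only [List.countP_append, List.countP_cons, countP_isSep_block, countP_isTick_block]
    simp [ChainSymbol.isTick, ChainSymbol.isSep]
    omega

theorem BackwardChain.not_forwardChain {γ : Type} {r : List γ → List γ → Prop} {i : ℕ}
    {x : List γ} {w : List (ChainSymbol γ)} (h : BackwardChain r i w) :
    ¬ ForwardChain r i (block x ++ .sep :: w) := by
  intro h'
  have h₁ := h.countP
  have h₂ := h'.countP
  simp only [List.countP_append, List.countP_cons, countP_isSep_block, countP_isTick_block] at h₂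
  simp [ChainSymbol.isTick, ChainSymbol.isSep] at h₂
  omega

/-! ### Separability for terminating computations -/

theorem PrefixSeparated.symm {α : Type} {A B : Set (List α)} (h : PrefixSeparated A B) :
    PrefixSeparated B A := by
  obtain ⟨N, hN⟩ := h
  exact ⟨N, fun u hu v hv huv => hN v hv u hu huv.symm⟩

theorem PrefixSeparated.of_empty {α : Type} {A B : Set (List α)} (h : ∀ v, v ∉ B) :
    PrefixSeparated A B :=
  ⟨0, fun _ _ v hv => absurd hv (h v)⟩

theorem PrefixSeparated.mono {α : Type} {A A' B B' : Set (List α)} (h : PrefixSeparated A' B')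
    (hA : ∀ u ∈ A, u ∈ A') (hB : ∀ v ∈ B, v ∈ B') : PrefixSeparated A B := by
  obtain ⟨N, hN⟩ := h
  exact ⟨N, fun u hu v hv => hN u (hA u hu) v (hB v hv)⟩

theorem PrefixSeparated.union_right {α : Type} {A B C : Set (List α)} (h₁ : PrefixSeparated A B)
    (h₂ : PrefixSeparated A C) : PrefixSeparated A (B ∪ C) := by
  obtain ⟨N₁, h₁⟩ := h₁
  obtain ⟨N₂, h₂⟩ := h₂
  refine ⟨max N₁ N₂, fun u hu v hv huv => ?_⟩
  have key : ∀ N ≤ max N₁ N₂, u.take N = v.take N := fun N hN => by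
    have := congrArg (List.take N) huv
    rwa [List.take_take, List.take_take, min_eq_left hN] at this
  obtain hv | hv := hv
  · exact h₁ u hu v hv (key _ (le_max_left _ _))
  · exact h₂ u hu v hv (key _ (le_max_right _ _))

theorem PrefixSeparated.union_left {α : Type} {A B C : Set (List α)} (h₁ : PrefixSeparated A C)
    (h₂ : PrefixSeparated B C) : PrefixSeparated (A ∪ B) C :=
  (h₁.symm.union_right h₂.symm).symm

/-- If all words of `A` start with `p`, then only those words of `B` matter which also do. -/
theorem PrefixSeparated.of_prefix {α : Type} {A B A' B' : Set (List α)} (p : List α)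
    (h : PrefixSeparated A' B') (hA : ∀ u ∈ A, ∃ u' ∈ A', u = p ++ u')
    (hB : ∀ v ∈ B, ∀ v', v = p ++ v' → v' ∈ B') : PrefixSeparated A B := by
  obtain ⟨N, hN⟩ := h
  refine ⟨p.length + N, fun u hu v hv huv => ?_⟩
  obtain ⟨u', hu', rfl⟩ := hA u hu
  rw [List.take_length_add_append] at huv
  have hp : v = p ++ (u'.take N ++ v.drop (p.length + N)) := by
    rw [← List.append_assoc, huv, List.take_append_drop]
  refine hN u' hu' _ (hB v hv _ hp) ?_
  rw [hp, List.take_length_add_append] at huv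
  exact List.append_cancel_left huv

/-- If the computation from `c` terminates, then a bounded prefix tells the backward chains which
start at `c` from the forward chains: the two constraints together force a word to follow the
computation, until the first deviation tells which of them is violated. -/
theorem prefixSeparated_of_dom {γ C : Type} {r : List γ → List γ → Prop} {enc : C → List γ}
    {step : C → Option C} (hr : ∀ c y, r (enc c) y ↔ ∃ c', step c = some c' ∧ y = enc c') {c : C}
    (hc : (StateTransition.eval step c).Dom) (i : ℕ) :
    PrefixSeparated {w | ∃ u, BackwardChain r i u ∧ w = block (enc c) ++ .sep :: u}
      {w | ForwardChain r i w} := by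
  let P : C → Prop := fun c => ∀ i,
    PrefixSeparated {w | ∃ u, BackwardChain r i u ∧ w = block (enc c) ++ .sep :: u}
      {w | ForwardChain r i w}
  have main : ∀ c, (∀ c' c'', step c = some c' → step c' = some c'' → P c'') → P c := by
    intro c hP i
    have hend : ∀ (x : List γ) (u v : List (ChainSymbol γ)),
        (ChainSymbol.finish :: u).take 1 ≠ (block x ++ .sep :: v).take 1 := by
      intro x u v
      cases x <;> simp [block]
    refine PrefixSeparated.of_prefix
      (A' := {.finish :: List.replicate i .tick} ∪
        {w | ∃ x y u, r x y ∧ BackwardChain r (i + 1) u ∧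
          w = block x.reverse ++ .sep :: (block y ++ .sep :: u)})
      (B' := {w | ∃ j, i < j ∧ w = .finish :: List.replicate j .tick} ∪
        {w | ∃ y u, r (enc c) y ∧ ForwardChain r (i + 1) u ∧
          w = block y.reverse ++ .sep :: u})
      (block (enc c) ++ [.sep]) ?_ ?_ ?_
    · refine .union_left (.union_right ?_ ?_) (.union_right ?_ ?_)
      -- Both chains end here: `i` ticks against more than `i`, told apart by `i + 2` symbols.
      · refine ⟨i + 2, ?_⟩
        rintro _ rfl _ ⟨j, hj, rfl⟩ h
        have := congrArg List.length h
        simp at this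
        omega
      · refine ⟨1, ?_⟩
        rintro _ rfl _ ⟨y, u, -, -, rfl⟩
        exact hend _ _ _
      · refine ⟨1, ?_⟩
        rintro _ ⟨x, y, u, -, -, rfl⟩ _ ⟨j, -, rfl⟩ h
        exact hend _ _ _ h.symm
      -- Both chains go on: the forward one fixes the successor of `c`, and with it the backward one
      -- fixes the successor of that, so that the bound for the latter can be used.
      · cases hc : step c with
        | none =>
          refine .of_empty ?_
          rintro _ ⟨y, u, hy, -⟩
          obtain ⟨c', h, -⟩ := (hr _ _).1 hy
          simp [hc] at h
        | some c' =>
          refine (PrefixSeparated.of_prefix (block (enc c').reverse ++ [.sep])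
            (A' := {w | ForwardChain r (i + 1) w})
            (B' := {w | ∃ y u, r (enc c') y ∧ BackwardChain r (i + 1) u ∧
              w = block y ++ .sep :: u}) ?_ ?_ ?_).symm
          · cases hc' : step c' with
            | none =>
              refine .of_empty ?_
              rintro _ ⟨y, u, hy, -⟩
              obtain ⟨c'', h, -⟩ := (hr _ _).1 hy
              simp [hc'] at h
            | some c'' =>
              refine (hP c' c'' hc hc' (i + 1)).symm.mono (fun _ h => h) ?_
              rintro _ ⟨y, u, hy, hu, rfl⟩
              obtain ⟨_, h, rfl⟩ := (hr _ _).1 hy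
              obtain rfl := Option.some.inj (hc'.symm.trans h)
              exact ⟨u, hu, rfl⟩
          · rintro _ ⟨y, u, hy, hu, rfl⟩
            obtain ⟨_, h, rfl⟩ := (hr _ _).1 hy
            obtain rfl := Option.some.inj (hc.symm.trans h)
            exact ⟨u, hu, by simp⟩
          · rintro _ ⟨x, y, u, hxy, hu, rfl⟩ v' h
            rw [List.append_assoc] at h
            obtain ⟨hx, rfl⟩ := block_append_sep_inj h
            obtain rfl := List.reverse_injective hx
            exact ⟨y, u, hxy, hu, rfl⟩
    · rintro _ ⟨u, hu, rfl⟩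
      refine ⟨u, ?_, by simp⟩
      cases hu with
      | base => exact .inl rfl
      | step h hw => exact .inr ⟨_, _, _, h, hw, rfl⟩
    · intro v hv v' h
      rw [List.append_assoc] at h
      cases hv with
      | base x hij =>
        obtain ⟨rfl, rfl⟩ := block_append_sep_inj h
        exact .inl ⟨_, hij, rfl⟩
      | step hxy hw =>
        obtain ⟨rfl, rfl⟩ := block_append_sep_inj h
        exact .inr ⟨_, _, hxy, hw, rfl⟩
  -- A round of both constraints makes two steps, hence the claim also for the successor.
  obtain ⟨b, hb⟩ := Part.dom_iff_mem.1 hc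
  have : P c ∧ ∀ c', step c = some c' → P c' := by
    refine StateTransition.evalInduction (C := fun c => P c ∧ ∀ c', step c = some c' → P c') hb ?_
    intro a _ ih
    exact ⟨main a fun c' c'' h h' => (ih c' h).2 c'' h', fun c' h => (ih c' h).1⟩
  exact this.1 i

/-! ### Inseparability for infinite computations -/

theorem exists_step_of_not_dom {C : Type} {step : C → Option C} {c : C}
    (hc : ¬ (StateTransition.eval step c).Dom) :
    ∃ c', step c = some c' ∧ ¬ (StateTransition.eval step c').Dom := by
  cases h : step c with
  | none =>
    exact absurd (Part.dom_iff_mem.2 ⟨c, StateTransition.mem_eval.2 ⟨.refl, h⟩⟩) hc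
  | some c' =>
    refine ⟨c', rfl, fun h' => hc ?_⟩
    rwa [StateTransition.reaches_eval (b := c') (.single h)]

/-- Along an infinite computation, chains of arbitrary length satisfy both constraints up to the
number of ticks at the end. -/
theorem exists_chain_of_not_dom {γ C : Type} {r : List γ → List γ → Prop} {enc : C → List γ}
    {step : C → Option C} (hr : ∀ c y, r (enc c) y ↔ ∃ c', step c = some c' ∧ y = enc c') (m : ℕ) :
    ∀ c, ¬ (StateTransition.eval step c).Dom → ∃ t : List (ChainSymbol γ),
      (∀ i, ∃ u, BackwardChain r i u ∧
        t ++ List.replicate (m + i) .tick = block (enc c) ++ .sep :: u) ∧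
      ∀ i j, m + i < j → ForwardChain r i (t ++ List.replicate j .tick) := by
  induction m with
  | zero =>
    intro c _
    refine ⟨block (enc c) ++ [.sep, .finish], fun i => ⟨_, .base i, by simp⟩, fun i j h => ?_⟩
    have := ForwardChain.base (r := r) (enc c) (i := i) (j := j) (by omega)
    simpa using this
  | succ m ih =>
    intro c hc
    obtain ⟨c', h, hc'⟩ := exists_step_of_not_dom hc
    obtain ⟨c'', h', hc''⟩ := exists_step_of_not_dom hc'
    obtain ⟨t, ht₁, ht₂⟩ := ih c'' hc''
    have hr₁ := (hr c _).2 ⟨c', h, rfl⟩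
    have hr₂ := (hr c' _).2 ⟨c'', h', rfl⟩
    refine ⟨block (enc c) ++ .sep :: (block (enc c').reverse ++ .sep :: t),
      fun i => ?_, fun i j hj => ?_⟩
    · obtain ⟨u, hu, hu'⟩ := ht₁ (i + 1)
      refine ⟨_, .step hr₂ hu, ?_⟩
      rw [← hu', show m + 1 + i = m + (i + 1) by omega]
      simp
    · have := ForwardChain.step hr₁ (ht₂ (i + 1) j (by omega))
      simpa using this

/-- If the computation from `c` is infinite, then a chain which follows it can satisfy either
constraint, depending only on the number of ticks at its end; no finite automaton can compare that
number with the length of the chain. -/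
theorem not_regularSeparable_of_not_dom {γ C : Type} {r : List γ → List γ → Prop}
    {enc : C → List γ} {step : C → Option C}
    (hr : ∀ c y, r (enc c) y ↔ ∃ c', step c = some c' ∧ y = enc c') {c : C}
    (hc : ¬ (StateTransition.eval step c).Dom) :
    ¬ RegularSeparable
      ({w | ∃ u, BackwardChain r 0 u ∧ w = block (enc c) ++ .sep :: u} : Language _)
      ({w | ForwardChain r 0 w} : Language _) := by
  rintro ⟨_, ⟨σ, _, M, rfl⟩, h₁, h₂⟩
  -- The automaton confuses `m` ticks with `2 m` ticks.
  obtain ⟨n, hn⟩ := exists_isIdempotentElem_pow (M.act [.tick])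
  obtain ⟨t, ht₁, ht₂⟩ := exists_chain_of_not_dom hr (n + 1) c hc
  refine h₂ _ (ht₂ 0 (n + 1 + (n + 1)) (by omega)) ?_
  rw [M.mem_accepts_iff_of_act_eq (v := t ++ List.replicate (n + 1 + 0) .tick)]
  · exact h₁ _ (ht₁ 0)
  · rw [DFA.act_append, DFA.act_append, DFA.act_replicate, DFA.act_replicate, pow_add, hn.eq,
      add_zero]

/-! ### The languages of chains are context-free -/

/-- A rewriting rule: the first letter of a word has to be `source` and becomes `target`, and at
some later position `old` is replaced by `new`. -/
structure RewriteRule (γ : Type) : Type where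
  source : γ
  old : List γ
  new : List γ
  target : γ

/-- One rewriting step. -/
def Rewrites {γ : Type} (ρ : List (RewriteRule γ)) (x y : List γ) : Prop :=
  ∃ p ∈ ρ, ∃ u v, x = p.source :: (u ++ p.old ++ v) ∧ y = p.target :: (u ++ p.new ++ v)

/-- All letters of configurations. -/
noncomputable def allLetters (γ : Type) [Fintype γ] : List (ChainSymbol γ) :=
  Finset.univ.toList.map .letter

theorem forall_mem_allLetters_iff {γ : Type} [Fintype γ] {s : List (ChainSymbol γ)} :
    (∀ a ∈ s, a ∈ allLetters γ) ↔ ∃ x, s = block x := by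
  constructor
  · intro h
    induction s with
    | nil => exact ⟨[], rfl⟩
    | cons a s ih =>
      obtain ⟨x, rfl⟩ := ih fun b hb => h b (List.mem_cons_of_mem _ hb)
      obtain ⟨b, -, rfl⟩ := List.mem_map.1 (h a List.mem_cons_self)
      exact ⟨b :: x, rfl⟩
  · rintro ⟨x, rfl⟩ a ha
    obtain ⟨b, -, rfl⟩ := List.mem_map.1 ha
    exact List.mem_map.2 ⟨b, by simp, rfl⟩

/-- A configuration and a reversed successor, for one rewriting rule. -/
noncomputable def forwardPair {γ : Type} [Fintype γ] (p : RewriteRule γ) :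
    CFExpr (ChainSymbol γ) :=
  .surround [.letter p.source]
    (.mirror (allLetters γ) (.surround (block p.old)
      (.mirror (allLetters γ) (.letter .sep)) (block p.new.reverse)))
    [.letter p.target, .sep]

/-- A reversed configuration and a successor of it, for one rewriting rule. -/
noncomputable def backwardPair {γ : Type} [Fintype γ] (p : RewriteRule γ) :
    CFExpr (ChainSymbol γ) :=
  .surround []
    (.mirror (allLetters γ) (.surround (block p.old.reverse)
      (.mirror (allLetters γ) (.surround [.letter p.source] (.letter .sep) [.letter p.target]))
      (block p.new)))
    [.sep]

theorem mem_forwardPair {γ : Type} [Fintype γ] {ρ : List (RewriteRule γ)}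
    {w : List (ChainSymbol γ)} : (CFExpr.unions (ρ.map forwardPair)).Mem w ↔
      ∃ x y, Rewrites ρ x y ∧ w = block x ++ .sep :: (block y.reverse ++ [.sep]) := by
  simp only [CFExpr.mem_unions, List.mem_map, exists_exists_and_eq_and]
  simp only [forwardPair, CFExpr.mem_surround, CFExpr.Mem, forall_mem_allLetters_iff]
  constructor
  · rintro ⟨p, hp, _, ⟨_, _, ⟨u, rfl⟩, ⟨_, ⟨_, _, ⟨v, rfl⟩, rfl, rfl⟩, rfl⟩, rfl⟩, rfl⟩
    refine ⟨_, _, ⟨p, hp, u, v, rfl, rfl⟩, ?_⟩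
    simp [block]
  · rintro ⟨_, _, ⟨p, hp, u, v, rfl, rfl⟩, rfl⟩
    refine ⟨p, hp, _, ⟨_, _, ⟨u, rfl⟩, ⟨_, ⟨_, _, ⟨v, rfl⟩, rfl, rfl⟩, rfl⟩, rfl⟩, ?_⟩
    simp [block]

theorem mem_backwardPair {γ : Type} [Fintype γ] {ρ : List (RewriteRule γ)}
    {w : List (ChainSymbol γ)} : (CFExpr.unions (ρ.map backwardPair)).Mem w ↔
      ∃ x y, Rewrites ρ x y ∧ w = block x.reverse ++ .sep :: (block y ++ [.sep]) := by
  simp only [CFExpr.mem_unions, List.mem_map, exists_exists_and_eq_and]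
  simp only [backwardPair, CFExpr.mem_surround, CFExpr.Mem, forall_mem_allLetters_iff]
  constructor
  · rintro ⟨p, hp, _, ⟨_, _, ⟨v, rfl⟩, ⟨_, ⟨_, _, ⟨u, rfl⟩, ⟨_, rfl, rfl⟩, rfl⟩, rfl⟩, rfl⟩, rfl⟩
    refine ⟨_, _, ⟨p, hp, u.reverse, v.reverse, rfl, rfl⟩, ?_⟩
    simp [block]
  · rintro ⟨_, _, ⟨p, hp, u, v, rfl, rfl⟩, rfl⟩
    refine ⟨p, hp, _, ⟨_, _, ⟨v.reverse, rfl⟩,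
      ⟨_, ⟨_, _, ⟨u.reverse, rfl⟩, ⟨_, rfl, rfl⟩, rfl⟩, rfl⟩, rfl⟩, ?_⟩
    simp [block]

/-- The backward chains with offset `0`. -/
noncomputable def backwardExpr {γ : Type} [Fintype γ] (ρ : List (RewriteRule γ)) :
    CFExpr (ChainSymbol γ) :=
  .lin (.unions (ρ.map backwardPair)) (.letter .finish) (.letter .tick)

/-- The end of a forward chain: a configuration, the end marker, and ticks. -/
noncomputable def lastBlock (γ : Type) [Fintype γ] : CFExpr (ChainSymbol γ) :=
  .star (.unions ((allLetters γ).map .letter))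
    (.surround [.sep, .finish] (.star (.letter .tick) (.letter .tick)) [])

/-- The forward chains with offset `0`. -/
noncomputable def forwardExpr {γ : Type} [Fintype γ] (ρ : List (RewriteRule γ)) :
    CFExpr (ChainSymbol γ) :=
  .lin (.unions (ρ.map forwardPair)) (lastBlock γ) (.letter .tick)

theorem mem_backwardExpr {γ : Type} [Fintype γ] {ρ : List (RewriteRule γ)}
    {w : List (ChainSymbol γ)} :
    (backwardExpr ρ).Mem w ↔ BackwardChain (Rewrites ρ) 0 w := by
  constructor
  · intro h
    suffices ∀ i, BackwardChain (Rewrites ρ) i (w ++ List.replicate i .tick) by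
      simpa using this 0
    change LinClosure _ _ _ w at h
    induction h with
    | base h =>
      obtain rfl := h
      exact fun i => .base i
    | step ha _ hb ih =>
      intro i
      obtain ⟨x, y, hxy, rfl⟩ := mem_backwardPair.1 ha
      obtain rfl := hb
      have := BackwardChain.step hxy (ih (i + 1))
      simpa [List.replicate_succ] using this
  · intro h
    suffices ∀ i w, BackwardChain (Rewrites ρ) i w →
        ∃ x, (backwardExpr ρ).Mem x ∧ w = x ++ List.replicate i .tick by
      obtain ⟨x, hx, rfl⟩ := this 0 w h
      simpa using hx
    intro i w h
    induction h with
    | base i => exact ⟨[.finish], .base rfl, rfl⟩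
    | step hxy _ ih =>
      obtain ⟨u, hu, rfl⟩ := ih
      refine ⟨_, LinClosure.step (mem_backwardPair.2 ⟨_, _, hxy, rfl⟩) hu rfl, ?_⟩
      simp [List.replicate_succ]

theorem mem_lastBlock {γ : Type} [Fintype γ] {w : List (ChainSymbol γ)} :
    (lastBlock γ).Mem w ↔
      ∃ (x : List γ) (k : ℕ), w = block x ++ .sep :: .finish :: List.replicate (k + 1) .tick := by
  have hticks : ∀ u : List (ChainSymbol γ),
      StarClosure (fun w => w = [.tick]) (fun w => w = [.tick]) u ↔
        ∃ k : ℕ, u = List.replicate (k + 1) .tick := by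
    intro u
    constructor
    · intro h
      induction h with
      | base h => exact ⟨0, h⟩
      | step ha _ ih =>
        obtain rfl := ha
        obtain ⟨k, rfl⟩ := ih
        exact ⟨k + 1, rfl⟩
    · rintro ⟨k, rfl⟩
      induction k with
      | zero => exact .base rfl
      | succ k ih => exact StarClosure.step (a := [ChainSymbol.tick]) rfl ih
  change StarClosure _ _ w ↔ _
  constructor
  · intro h
    induction h with
    | base h =>
      obtain ⟨_, hu, rfl⟩ := CFExpr.mem_surround.1 h
      obtain ⟨k, rfl⟩ := (hticks _).1 hu
      exact ⟨[], k, by simp [block]⟩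
    | step ha _ ih =>
      obtain ⟨_, he, h⟩ := CFExpr.mem_unions.1 ha
      obtain ⟨a, hal, rfl⟩ := List.mem_map.1 he
      obtain ⟨b, -, rfl⟩ := List.mem_map.1 hal
      obtain rfl := h
      obtain ⟨x, k, rfl⟩ := ih
      exact ⟨b :: x, k, rfl⟩
  · rintro ⟨x, k, rfl⟩
    induction x with
    | nil => exact .base (CFExpr.mem_surround.2 ⟨_, (hticks _).2 ⟨k, rfl⟩, by simp [block]⟩)
    | cons b x ih =>
      have hb : (CFExpr.letter (ChainSymbol.letter b)).Mem [ChainSymbol.letter b] := rfl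
      refine StarClosure.step (a := [ChainSymbol.letter b]) (CFExpr.mem_unions.2 ⟨_, ?_, hb⟩) ih
      exact List.mem_map.2 ⟨_, List.mem_map.2 ⟨b, by simp, rfl⟩, rfl⟩

theorem mem_forwardExpr {γ : Type} [Fintype γ] {ρ : List (RewriteRule γ)}
    {w : List (ChainSymbol γ)} :
    (forwardExpr ρ).Mem w ↔ ForwardChain (Rewrites ρ) 0 w := by
  constructor
  · intro h
    suffices ∀ i, ForwardChain (Rewrites ρ) i (w ++ List.replicate i .tick) by
      simpa using this 0
    change LinClosure _ _ _ w at h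
    induction h with
    | base h =>
      obtain ⟨x, k, rfl⟩ := mem_lastBlock.1 h
      intro i
      have := ForwardChain.base (r := Rewrites ρ) (i := i) (j := k + 1 + i) x (by omega)
      rw [List.replicate_add] at this
      simpa using this
    | step ha _ hb ih =>
      intro i
      obtain ⟨x, y, hxy, rfl⟩ := mem_forwardPair.1 ha
      obtain rfl := hb
      have := ForwardChain.step hxy (ih (i + 1))
      simpa [List.replicate_succ] using this
  · intro h
    suffices ∀ i w, ForwardChain (Rewrites ρ) i w →
        ∃ x, (forwardExpr ρ).Mem x ∧ w = x ++ List.replicate i .tick by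
      obtain ⟨x, hx, rfl⟩ := this 0 w h
      simpa using hx
    intro i w h
    induction h with
    | @base i j x h =>
      obtain ⟨k, rfl⟩ := Nat.exists_eq_add_of_lt h
      refine ⟨_, LinClosure.base (mem_lastBlock.2 ⟨x, k, rfl⟩), ?_⟩
      rw [show i + k + 1 = k + 1 + i by omega, List.replicate_add]
      simp
    | step hxy _ ih =>
      obtain ⟨u, hu, rfl⟩ := ih
      refine ⟨_, LinClosure.step (mem_forwardPair.2 ⟨_, _, hxy, rfl⟩) hu rfl, ?_⟩
      simp [List.replicate_succ]

/-! ### Stack machines as rewriting systems -/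

/-- A machine with finitely many stacks: a state either halts, or determines a stack, and, from
the letter at the top of that stack if there is one, a new state and a word which replaces the
letter. -/
abbrev StackMachine (K Γ Q : Type) : Type := Q → Option (K × (Option Γ → Q × List Γ))

/-- One step of a stack machine. -/
def StackMachine.step {K Γ Q : Type} [DecidableEq K] (δ : StackMachine K Γ Q)
    (c : Q × (K → List Γ)) : Option (Q × (K → List Γ)) :=
  (δ c.1).map fun p => ((p.2 (c.2 p.1).head?).1,
    Function.update c.2 p.1 ((p.2 (c.2 p.1).head?).2 ++ (c.2 p.1).tail))

/-- Letters for configurations of stack machines: states, a mark in front of each stack, a mark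
after each stack, and the letters on the stacks. -/
inductive StackSymbol (K Γ Q : Type) : Type
  | state (q : Q)
  | top (k : K)
  | bottom
  | sym (a : Γ)
  deriving Fintype

/-- The stacks, one after another. -/
noncomputable def encodeStacks {K Γ : Type} [Fintype K] (Q : Type) (S : K → List Γ) :
    List (StackSymbol K Γ Q) :=
  (Finset.univ : Finset K).toList.flatMap fun k => .top k :: ((S k).map .sym ++ [.bottom])

/-- A configuration of a stack machine as a word. -/
noncomputable def encodeConfig {K Γ Q : Type} [Fintype K] (c : Q × (K → List Γ)) :
    List (StackSymbol K Γ Q) :=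
  .state c.1 :: encodeStacks Q c.2

/-- Changing one stack changes an encoded configuration only behind the mark of that stack, which
occurs nowhere else. -/
theorem exists_encodeStacks_update {K Γ : Type} [Fintype K] [DecidableEq K] (Q : Type)
    (S : K → List Γ) (k : K) :
    ∃ pre post : List (StackSymbol K Γ Q), .top k ∉ pre ∧ .top k ∉ post ∧
      ∀ s, encodeStacks Q (Function.update S k s) =
        pre ++ .top k :: (s.map .sym ++ .bottom :: post) := by
  obtain ⟨a, b, hab⟩ := List.append_of_mem (Finset.mem_toList.2 (Finset.mem_univ k))
  have hnd : (a ++ k :: b).Nodup := hab ▸ Finset.nodup_toList _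
  have hk : k ∉ a ∧ k ∉ b := by
    rw [List.nodup_middle, List.nodup_cons] at hnd
    simpa using hnd.1
  have hne : ∀ l : List K, k ∉ l → StackSymbol.top k ∉
      l.flatMap fun k => (.top k :: ((S k).map .sym ++ [.bottom]) : List (StackSymbol K Γ Q)) := by
    intro l hl h
    simp only [List.mem_flatMap, List.mem_cons, StackSymbol.top.injEq, List.mem_append,
      List.mem_map, reduceCtorEq, and_false, exists_false, List.not_mem_nil, or_false,
      exists_eq_right'] at h
    exact hl h
  have hupd : ∀ (s : List Γ) (l : List K), k ∉ l →
      (l.flatMap fun j => (.top j :: ((Function.update S k s j).map .sym ++ [.bottom]) :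
        List (StackSymbol K Γ Q))) =
      l.flatMap fun j => .top j :: ((S j).map .sym ++ [.bottom]) := by
    intro s l hl
    refine List.flatMap_congr fun j hj => ?_
    rw [Function.update_of_ne]
    rintro rfl
    exact hl hj
  refine ⟨_, _, hne a hk.1, hne b hk.2, fun s => ?_⟩
  rw [encodeStacks, hab, List.flatMap_append, List.flatMap_cons, hupd s a hk.1, hupd s b hk.2]
  simp

/-- The rewriting rule for a state, the stack and the instruction which it determines, and the
letter at the top of that stack. -/
def stackRule {K Γ Q : Type} (q : Q) (k : K) (f : Option Γ → Q × List Γ) :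
    Option Γ → RewriteRule (StackSymbol K Γ Q)
  | none => ⟨.state q, [.top k, .bottom], .top k :: ((f none).2.map .sym ++ [.bottom]),
      .state (f none).1⟩
  | some a => ⟨.state q, [.top k, .sym a], .top k :: (f (some a)).2.map .sym,
      .state (f (some a)).1⟩

/-- The rewriting rules of a stack machine. -/
noncomputable def StackMachine.rewriteRules {K Γ Q : Type} [Fintype Γ] [Fintype Q]
    (δ : StackMachine K Γ Q) : List (RewriteRule (StackSymbol K Γ Q)) :=
  (Finset.univ : Finset Q).toList.flatMap fun q =>
    (δ q).toList.flatMap fun p => (Finset.univ : Finset (Option Γ)).toList.map (stackRule q p.1 p.2)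

theorem StackMachine.mem_rewriteRules {K Γ Q : Type} [Fintype Γ] [Fintype Q]
    {δ : StackMachine K Γ Q} {p : RewriteRule (StackSymbol K Γ Q)} :
    p ∈ δ.rewriteRules ↔ ∃ q k f t, δ q = some (k, f) ∧ p = stackRule q k f t := by
  simp only [rewriteRules, List.mem_flatMap, Finset.mem_toList, Finset.mem_univ, true_and,
    Option.mem_toList, List.mem_map, Prod.exists, eq_comm (a := p)]
  constructor
  · rintro ⟨q, k, f, h, t, ht⟩
    exact ⟨q, k, f, t, h, ht⟩
  · rintro ⟨q, k, f, t, h, ht⟩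
    exact ⟨q, k, f, h, t, ht⟩

/-- On encoded configurations the rewriting rules allow exactly the step of the machine. -/
theorem StackMachine.rewrites_iff {K Γ Q : Type} [Fintype K] [DecidableEq K] [Fintype Γ]
    [Fintype Q] (δ : StackMachine K Γ Q) (c : Q × (K → List Γ))
    (y : List (StackSymbol K Γ Q)) :
    Rewrites δ.rewriteRules (encodeConfig c) y ↔
      ∃ c', δ.step c = some c' ∧ y = encodeConfig c' := by
  obtain ⟨q, S⟩ := c
  constructor
  · rintro ⟨p, hp, u, v, hx, rfl⟩
    obtain ⟨q', k, f, t, hδ, rfl⟩ := mem_rewriteRules.1 hp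
    obtain ⟨pre, post, hpre, hpost, hS⟩ := exists_encodeStacks_update Q S k
    have hSk := hS (S k)
    rw [Function.update_eq_self] at hSk
    have hmem : (.top k : StackSymbol K Γ Q) ∉ (S k).map .sym ++ .bottom :: post := by
      simp [hpost]
    cases t with
    | none =>
      simp only [encodeConfig, stackRule, hSk, List.cons.injEq, StackSymbol.state.injEq,
        List.append_assoc, List.cons_append, List.nil_append] at hx
      obtain ⟨rfl, hx⟩ := hx
      obtain ⟨rfl, -, hv⟩ := (List.append_cons_inj_of_notMem hpre hmem).1 hx
      obtain hk | ⟨a, s, hk⟩ : S k = [] ∨ ∃ a s, S k = a :: s := by cases S k <;> simp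
      · obtain rfl : post = v := by simpa [hk] using hv
        refine ⟨_, by rw [step, hδ]; rfl, ?_⟩
        simp [encodeConfig, stackRule, hS, hk]
      · simp [hk] at hv
    | some a =>
      simp only [encodeConfig, stackRule, hSk, List.cons.injEq, StackSymbol.state.injEq,
        List.append_assoc, List.cons_append, List.nil_append] at hx
      obtain ⟨rfl, hx⟩ := hx
      obtain ⟨rfl, -, hv⟩ := (List.append_cons_inj_of_notMem hpre hmem).1 hx
      obtain hk | ⟨b, s, hk⟩ : S k = [] ∨ ∃ a s, S k = a :: s := by cases S k <;> simp
      · simp [hk] at hv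
      · simp only [hk, List.map_cons, List.cons_append, List.cons.injEq,
          StackSymbol.sym.injEq] at hv
        obtain ⟨rfl, rfl⟩ := hv
        refine ⟨_, by rw [step, hδ]; rfl, ?_⟩
        simp [encodeConfig, stackRule, hS, hk]
  · rintro ⟨c', hc', rfl⟩
    rw [step, Option.map_eq_some_iff] at hc'
    obtain ⟨⟨k, f⟩, hδ, rfl⟩ := hc'
    obtain ⟨pre, post, -, -, hS⟩ := exists_encodeStacks_update Q S k
    have hSk := hS (S k)
    rw [Function.update_eq_self] at hSk
    refine ⟨_, mem_rewriteRules.2 ⟨q, k, f, (S k).head?, hδ, rfl⟩, pre, ?_⟩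
    cases hk : S k with
    | nil => exact ⟨post, by simp [encodeConfig, stackRule, hSk, hk],
        by simp [encodeConfig, stackRule, hS, hk]⟩
    | cons a s => exact ⟨s.map .sym ++ .bottom :: post, by simp [encodeConfig, stackRule, hSk, hk],
        by simp [encodeConfig, stackRule, hS, hk]⟩

/-! ### From `TM2` machines to stack machines -/

section

open Turing

variable {K Γ Λ σ : Type}

/-- The statements of a `TM2` machine with labels in `L`, `none` for the end of the program. -/
abbrev ProgramPoint (M : Λ → TM2.Stmt (fun _ : K => Γ) Λ σ) (L : Finset Λ) : Type :=
  {s // s ∈ TM2.stmts M L}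

open scoped Classical in
/-- A statement as a program point; statements outside of the program are mapped to its end. -/
noncomputable def toProgramPoint (M : Λ → TM2.Stmt (fun _ : K => Γ) Λ σ) (L : Finset Λ)
    (s : Option (TM2.Stmt (fun _ : K => Γ) Λ σ)) : ProgramPoint M L :=
  if h : s ∈ TM2.stmts M L then ⟨s, h⟩ else ⟨none, by simp [TM2.stmts]⟩

/-- The stack machine which executes the elementary statements of a `TM2` machine one by one. -/
noncomputable def stackMachineOf [Inhabited K] (M : Λ → TM2.Stmt (fun _ : K => Γ) Λ σ)
    (L : Finset Λ) : StackMachine K Γ (ProgramPoint M L × σ) := fun q =>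
  match q.1.1 with
  | none => none
  | some (.push k f s) =>
      some (k, fun t => ((toProgramPoint M L (some s), q.2), f q.2 :: t.toList))
  | some (.peek k f s) =>
      some (k, fun t => ((toProgramPoint M L (some s), f q.2 t), t.toList))
  | some (.pop k f s) => some (k, fun t => ((toProgramPoint M L (some s), f q.2 t), []))
  | some (.load a s) =>
      some (default, fun t => ((toProgramPoint M L (some s), a q.2), t.toList))
  | some (.branch p s₁ s₂) =>
      some (default, fun t =>
        ((toProgramPoint M L (some (cond (p q.2) s₁ s₂)), q.2), t.toList))
  | some (.goto l) =>
      some (default, fun t => ((toProgramPoint M L (some (M (l q.2))), q.2), t.toList))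
  | some .halt => some (default, fun t => ((toProgramPoint M L none, q.2), t.toList))

theorem toProgramPoint_val {M : Λ → TM2.Stmt (fun _ : K => Γ) Λ σ} {L : Finset Λ}
    {s : Option (TM2.Stmt (fun _ : K => Γ) Λ σ)} (h : s ∈ TM2.stmts M L) :
    (toProgramPoint M L s).1 = s := by
  rw [toProgramPoint, dif_pos h]

theorem some_mem_stmts {M : Λ → TM2.Stmt (fun _ : K => Γ) Λ σ} {L : Finset Λ} {l : Λ}
    (h : l ∈ L) : some (M l) ∈ TM2.stmts M L := by
  classical
  rw [TM2.stmts, Finset.some_mem_insertNone, Finset.mem_biUnion]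
  exact ⟨l, h, TM2.stmts₁_self⟩

/-- Configurations of a `TM2` machine and of its stack machine which correspond to each other. -/
def SameConfig {M : Λ → TM2.Stmt (fun _ : K => Γ) Λ σ} {L : Finset Λ}
    (c : TM2.Cfg (fun _ : K => Γ) Λ σ) (d : (ProgramPoint M L × σ) × (K → List Γ)) : Prop :=
  d.1.1.1 = c.l.map M ∧ d.1.2 = c.var ∧ d.2 = c.stk

theorem toList_head?_append_tail {α : Type} (l : List α) : l.head?.toList ++ l.tail = l := by
  cases l <;> rfl

/-- A step of a `TM2` machine is a sequence of elementary statements, each of which the stack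
machine executes in one step. -/
theorem exists_reaches₁_stepAux [DecidableEq K] [Inhabited K] [Inhabited Λ]
    {M : Λ → TM2.Stmt (fun _ : K => Γ) Λ σ} {L : Finset Λ}
    (hL : TM2.Supports M L) (s : TM2.Stmt (fun _ : K => Γ) Λ σ) :
    ∀ (q : ProgramPoint M L) (v : σ) (S : K → List Γ), q.1 = some s →
      ∃ d, StateTransition.Reaches₁ (stackMachineOf M L).step ((q, v), S) d ∧
        SameConfig (TM2.stepAux s v S) d := by
  have hstep : ∀ (q : ProgramPoint M L) (v : σ) (S : K → List Γ) k f,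
      stackMachineOf M L (q, v) = some (k, f) →
      (stackMachineOf M L).step ((q, v), S) = some ((f (S k).head?).1,
        Function.update S k ((f (S k).head?).2 ++ (S k).tail)) := by
    intro q v S k f h
    rw [StackMachine.step, h]
    rfl
  induction s with
  | push k f s ih =>
    rintro ⟨_, hq⟩ v S rfl
    have hs := toProgramPoint_val (TM2.stmts_trans
      (by simp [TM2.stmts₁, TM2.stmts₁_self] :
        s ∈ TM2.stmts₁ (.push k f s)) hq)
    obtain ⟨d, hd, hd'⟩ := ih _ v (Function.update S k (f v :: S k)) hs
    refine ⟨d, .head ?_ hd, hd'⟩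
    rw [hstep _ _ _ _ _ rfl]
    simp [toList_head?_append_tail]
  | peek k f s ih =>
    rintro ⟨_, hq⟩ v S rfl
    have hs := toProgramPoint_val (TM2.stmts_trans
      (by simp [TM2.stmts₁, TM2.stmts₁_self] :
        s ∈ TM2.stmts₁ (.peek k f s)) hq)
    obtain ⟨d, hd, hd'⟩ := ih _ (f v (S k).head?) S hs
    refine ⟨d, .head ?_ hd, hd'⟩
    rw [hstep _ _ _ _ _ rfl]
    simp [toList_head?_append_tail]
  | pop k f s ih =>
    rintro ⟨_, hq⟩ v S rfl
    have hs := toProgramPoint_val (TM2.stmts_trans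
      (by simp [TM2.stmts₁, TM2.stmts₁_self] :
        s ∈ TM2.stmts₁ (.pop k f s)) hq)
    obtain ⟨d, hd, hd'⟩ := ih _ (f v (S k).head?) (Function.update S k (S k).tail) hs
    refine ⟨d, .head ?_ hd, hd'⟩
    rw [hstep _ _ _ _ _ rfl]
    simp
  | load a s ih =>
    rintro ⟨_, hq⟩ v S rfl
    have hs := toProgramPoint_val (TM2.stmts_trans
      (by simp [TM2.stmts₁, TM2.stmts₁_self] :
        s ∈ TM2.stmts₁ (.load a s)) hq)
    obtain ⟨d, hd, hd'⟩ := ih _ (a v) S hs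
    refine ⟨d, .head ?_ hd, hd'⟩
    rw [hstep _ _ _ _ _ rfl]
    simp [toList_head?_append_tail]
  | branch p s₁ s₂ ih₁ ih₂ =>
    rintro ⟨_, hq⟩ v S rfl
    have hmem : cond (p v) s₁ s₂ ∈ TM2.stmts₁ (.branch p s₁ s₂) := by
      cases p v <;> simp [TM2.stmts₁, TM2.stmts₁_self]
    have hs := toProgramPoint_val (TM2.stmts_trans hmem hq)
    have hd : ∃ d, StateTransition.Reaches₁ (stackMachineOf M L).step
        ((toProgramPoint M L (some (cond (p v) s₁ s₂)), v), S) d ∧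
          SameConfig (TM2.stepAux (.branch p s₁ s₂) v S) d := by
      rw [TM2.stepAux]
      cases hp : p v
      · rw [hp] at hs
        exact ih₂ _ v S hs
      · rw [hp] at hs
        exact ih₁ _ v S hs
    obtain ⟨d, hd, hd'⟩ := hd
    refine ⟨d, .head ?_ hd, hd'⟩
    rw [hstep _ _ _ _ _ rfl]
    simp [toList_head?_append_tail]
  | goto l =>
    rintro ⟨_, hq⟩ v S rfl
    refine ⟨_, .single (hstep _ _ _ _ _ rfl), ?_, rfl, ?_⟩
    · exact toProgramPoint_val (some_mem_stmts (TM2.stmts_supportsStmt hL hq v))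
    · simp [toList_head?_append_tail]
  | halt =>
    rintro ⟨_, hq⟩ v S rfl
    refine ⟨_, .single (hstep _ _ _ _ _ rfl), ?_, rfl, ?_⟩
    · exact toProgramPoint_val (by simp [TM2.stmts])
    · simp [toList_head?_append_tail]

theorem respects_stackMachineOf [DecidableEq K] [Inhabited K] [Inhabited Λ]
    {M : Λ → TM2.Stmt (fun _ : K => Γ) Λ σ} {L : Finset Λ} (hL : TM2.Supports M L) :
    StateTransition.Respects (TM2.step M) (stackMachineOf M L).step SameConfig := by
  rintro ⟨l, v, S⟩ ⟨⟨q, v'⟩, S'⟩ ⟨hq, hv, hS⟩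
  obtain rfl : v' = v := hv
  obtain rfl : S' = S := hS
  cases l with
  | none =>
    obtain ⟨_, h⟩ := q
    obtain rfl : _ = none := hq
    rfl
  | some l =>
    obtain ⟨d, hd, hd'⟩ := exists_reaches₁_stepAux hL (M l) q v' S' hq
    exact ⟨d, hd', hd⟩

end

/-! ### The universal machine -/

instance : Fintype Turing.PartrecToTM2.K' :=
  ⟨{.main, .rev, .aux, .stack}, fun k => by cases k <;> simp⟩

section

open Turing

/-- There is a fixed rewriting system, deterministic on configurations, for which termination is
the halting problem; the input is written in binary at a fixed position in the initial
configuration. -/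
theorem exists_universal_rewriting : ∃ (γ : Type) (_ : Fintype γ) (C : Type)
    (step : C → Option C) (enc : C → List γ) (ρ : List (RewriteRule γ)) (init : ℕ → C)
    (sym : PartrecToTM2.Γ' → γ) (pre post : List γ),
    (∀ c y, Rewrites ρ (enc c) y ↔ ∃ c', step c = some c' ∧ y = enc c') ∧
    (∀ n, enc (init n) = pre ++ (PartrecToTM2.trNat n).map sym ++ post) ∧
    ∀ n, (StateTransition.eval step (init n)).Dom ↔
      (Nat.Partrec.Code.eval (Denumerable.ofNat Nat.Partrec.Code n) 0).Dom := by
  have hu : Partrec fun n : ℕ => Nat.Partrec.Code.eval (Denumerable.ofNat Nat.Partrec.Code n) 0 :=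
    Nat.Partrec.Code.eval_part.comp (Computable.ofNat _) (Computable.const 0)
  obtain ⟨c, hc⟩ := ToPartrec.Code.exists_code (Nat.Partrec'.part_iff₁.2 hu)
  let L := PartrecToTM2.codeSupp c .halt
  let _ : Inhabited PartrecToTM2.Λ' := ⟨PartrecToTM2.trNormal c .halt⟩
  have hL : TM2.Supports PartrecToTM2.tr L := PartrecToTM2.tr_supports c .halt
  let δ := stackMachineOf PartrecToTM2.tr L
  let q : ProgramPoint PartrecToTM2.tr L × Option PartrecToTM2.Γ' :=
    (⟨some (PartrecToTM2.tr (PartrecToTM2.trNormal c .halt)), some_mem_stmts hL.1⟩, none)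
  obtain ⟨pre, post, -, -, hS⟩ := exists_encodeStacks_update
    (ProgramPoint PartrecToTM2.tr L × Option PartrecToTM2.Γ')
    (PartrecToTM2.K'.elim ([] : List PartrecToTM2.Γ') [] [] []) .main
  refine ⟨_, inferInstance, _, δ.step, encodeConfig, δ.rewriteRules,
    fun n => (q, PartrecToTM2.K'.elim (PartrecToTM2.trList [n]) [] [] []), .sym,
    .state q :: (pre ++ [.top .main]), .sym .cons :: .bottom :: post, δ.rewrites_iff,
    fun n => ?_, fun n => ?_⟩
  · have := hS (PartrecToTM2.trList [n])
    rw [PartrecToTM2.K'.elim_update_main] at this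
    rw [encodeConfig, this]
    simp [PartrecToTM2.trList]
  · have h₁ := StateTransition.tr_eval_dom (respects_stackMachineOf hL)
      (a₁ := PartrecToTM2.init c [n])
      (a₂ := (q, PartrecToTM2.K'.elim (PartrecToTM2.trList [n]) [] [] [])) ⟨rfl, rfl, rfl⟩
    rw [h₁, PartrecToTM2.tr_eval]
    have := hc (n ::ᵥ List.Vector.nil)
    change c.eval [n] = _ at this
    rw [this]
    rfl

end

/-! ### Visibly pushdown automata for flattened trees -/

/-- Flattened trees as nested words: brackets become a call and a return, letters internal. -/
def FlatSymbol.toTagged {α : Type} (a₀ : α) : FlatSymbol α → Tagged α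
  | .letter t => .internal t
  | .opening => .call a₀
  | .closing => .ret a₀

/-- A left inverse of `FlatSymbol.toTagged`. -/
def Tagged.toFlat {α : Type} : Tagged α → FlatSymbol α
  | .internal t => .letter t
  | .call _ => .opening
  | .ret _ => .closing

theorem Tagged.toFlat_toTagged {α : Type} (a₀ : α) :
    Function.LeftInverse Tagged.toFlat (FlatSymbol.toTagged a₀) := by
  intro x
  cases x <;> rfl

/-- The letters which a right-hand side generates without brackets. -/
def BFGBody.letters {α : Type} : BFGBody α → List α
  | .letter t => [t]
  | .leaf => []
  | .node _ _ => []

/-- The possible sequences of nonterminals between the brackets of a right-hand side. -/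
def BFGBody.children {α : Type} : BFGBody α → List (List ℕ)
  | .letter _ => []
  | .leaf => [[]]
  | .node N₁ N₂ => [[N₁, N₂]]

/-- The nonterminals which are left between the brackets of a right-hand side after the first
one. -/
def BFGBody.pending {α : Type} : BFGBody α → List (List ℕ)
  | .letter _ => []
  | .leaf => []
  | .node _ N₂ => [[N₂]]

/-- The automaton keeps in its state the nonterminals which are still to be read on the current
level of nesting, and whether that level is the outermost one.  These are the values which can
remain after a nonterminal has been read. -/
def vpaRests {α : Type} (R : List (ℕ × BFGBody α)) : List (Bool × List ℕ) :=
  (true, []) :: (false, []) :: R.flatMap fun r => r.2.pending.map fun l => (false, l)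

/-- An automaton for the flattened trees generated from one of the nonterminals `starts`. -/
def vpaOf {α : Type} (a₀ : α) (R : List (ℕ × BFGBody α)) (starts : List ℕ) : VPA α where
  initial := starts.map fun N => Encodable.encode (true, [N])
  final := [Encodable.encode (true, ([] : List ℕ))]
  calls := R.flatMap fun r => r.2.children.flatMap fun l => (vpaRests R).map fun s =>
    (Encodable.encode (s.1, r.1 :: s.2), a₀, Encodable.encode (false, l), Encodable.encode s)
  internals := R.flatMap fun r => r.2.letters.flatMap fun t => (vpaRests R).map fun s =>
    (Encodable.encode (s.1, r.1 :: s.2), t, Encodable.encode s)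
  returns := (vpaRests R).map fun s =>
    (Encodable.encode (false, ([] : List ℕ)), a₀, some (Encodable.encode s), Encodable.encode s)

/-- `StackGen R l st w`: the word `w` consists of flattened trees for the nonterminals in `l`, a
closing bracket, trees for the first list in `st`, a closing bracket, and so on. -/
inductive StackGen {α : Type} (R : List (ℕ × BFGBody α)) :
    List ℕ → List (List ℕ) → List (FlatSymbol α) → Prop
  | nil : StackGen R [] [] []
  | tree {N : ℕ} {l : List ℕ} {st : List (List ℕ)} {u v : List (FlatSymbol α)}
      (hu : FlatGen R N u) (hv : StackGen R l st v) : StackGen R (N :: l) st (u ++ v)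
  | close {l : List ℕ} {st : List (List ℕ)} {v : List (FlatSymbol α)} (hv : StackGen R l st v) :
      StackGen R [] (l :: st) (.closing :: v)

/-- Stacks of the automaton; the flag with a list says whether it belongs to the outermost level,
which is the case exactly for the lowest one. -/
def encodeStack : List (List ℕ) → List ℕ
  | [] => []
  | l :: st => Encodable.encode (st.isEmpty, l) :: encodeStack st

/-- An accepting run from a state and a stack that stand for `l` and `st` reads trees for them. -/
theorem StackGen.exists_of_run {α : Type} {a₀ : α} {R : List (ℕ × BFGBody α)} {starts : List ℕ}
    {c c' : ℕ × List ℕ} {w : List (Tagged α)} (h : (vpaOf a₀ R starts).Run c w c')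
    (hc' : c'.1 = Encodable.encode (true, ([] : List ℕ))) :
    ∀ (l : List ℕ) (st : List (List ℕ)),
      c = (Encodable.encode (st.isEmpty, l), encodeStack st) →
      ∃ x, StackGen R l st x ∧ w = x.map (FlatSymbol.toTagged a₀) := by
  induction h with
  | nil c =>
    rintro l st rfl
    simp only [Encodable.encode_inj, Prod.mk.injEq, List.isEmpty_iff] at hc'
    obtain ⟨rfl, rfl⟩ := hc'
    exact ⟨[], .nil, rfl⟩
  | cons h hw ih =>
    have ih := ih hc'
    rintro l st hc
    cases h with
    | call h =>
      obtain ⟨hq, rfl⟩ := Prod.mk.inj hc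
      simp only [vpaOf, List.mem_flatMap, List.mem_map, Prod.mk.injEq] at h
      obtain ⟨⟨N, b⟩, hb, l', hl', ⟨e, s⟩, hs, h₁, rfl, rfl, rfl⟩ := h
      rw [← h₁] at hq
      simp only [Encodable.encode_inj, Prod.mk.injEq] at hq
      obtain ⟨rfl, rfl⟩ := hq
      obtain ⟨x, hx, rfl⟩ := ih l' (s :: st) rfl
      cases b with
      | letter t => simp [BFGBody.children] at hl'
      | leaf =>
        obtain rfl := List.mem_singleton.1 hl'
        cases hx with
        | close hv => exact ⟨_, .tree (.leaf hb) hv, rfl⟩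
      | node N₁ N₂ =>
        obtain rfl := List.mem_singleton.1 hl'
        cases hx with
        | tree h₁ hx =>
          cases hx with
          | tree h₂ hx =>
            cases hx with
            | close hv =>
              exact ⟨_, .tree (.node hb h₁ h₂) hv, by simp [FlatSymbol.toTagged]⟩
    | internal h =>
      obtain ⟨hq, rfl⟩ := Prod.mk.inj hc
      simp only [vpaOf, List.mem_flatMap, List.mem_map, Prod.mk.injEq] at h
      obtain ⟨⟨N, b⟩, hb, t, ht, ⟨e, s⟩, hs, h₁, rfl, rfl⟩ := h
      rw [← h₁] at hq
      simp only [Encodable.encode_inj, Prod.mk.injEq] at hq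
      obtain ⟨rfl, rfl⟩ := hq
      obtain ⟨x, hx, rfl⟩ := ih s st rfl
      cases b with
      | letter t' =>
        obtain rfl := List.mem_singleton.1 ht
        exact ⟨_, .tree (.letter hb) hx, rfl⟩
      | leaf => simp [BFGBody.letters] at ht
      | node N₁ N₂ => simp [BFGBody.letters] at ht
    | pop h =>
      obtain ⟨hq, hst⟩ := Prod.mk.inj hc
      simp only [vpaOf, List.mem_map, Prod.mk.injEq, Option.some.injEq] at h
      obtain ⟨⟨e, s⟩, hs, h₁, rfl, rfl, rfl⟩ := h
      rw [← h₁] at hq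
      simp only [Encodable.encode_inj, Prod.mk.injEq] at hq
      obtain ⟨hst', rfl⟩ := hq
      cases st with
      | nil => simp at hst'
      | cons l' st =>
        simp only [encodeStack, List.cons.injEq, Encodable.encode_inj, Prod.mk.injEq] at hst
        obtain ⟨⟨rfl, rfl⟩, rfl⟩ := hst
        obtain ⟨x, hx, rfl⟩ := ih s st rfl
        exact ⟨_, .close hx, rfl⟩
    | bottom h => simp [vpaOf] at h

theorem VPA.Run.append {σ : Type} {A : VPA σ} {c c' c'' : ℕ × List ℕ} {u v : List (Tagged σ)}
    (hu : A.Run c u c') (hv : A.Run c' v c'') : A.Run c (u ++ v) c'' := by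
  induction hu with
  | nil => exact hv
  | cons h _ ih => exact .cons h (ih hv)

theorem FlatGen.run {α : Type} (a₀ : α) {R : List (ℕ × BFGBody α)} (starts : List ℕ) {N : ℕ}
    {w : List (FlatSymbol α)} (h : FlatGen R N w) :
    ∀ s ∈ vpaRests R, ∀ st : List ℕ, (vpaOf a₀ R starts).Run
      (Encodable.encode (s.1, N :: s.2), st) (w.map (FlatSymbol.toTagged a₀))
      (Encodable.encode s, st) := by
  have hcall : ∀ {N b l s} {st : List ℕ}, (N, b) ∈ R → l ∈ b.children → s ∈ vpaRests R →
      (vpaOf a₀ R starts).Step (Encodable.encode (s.1, N :: s.2), st) (.call a₀)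
        (Encodable.encode (false, l), Encodable.encode s :: st) := by
    intro N b l s st hb hl hs
    exact .call (List.mem_flatMap.2 ⟨_, hb, List.mem_flatMap.2 ⟨_, hl,
      List.mem_map.2 ⟨_, hs, rfl⟩⟩⟩)
  have hpop : ∀ {s} {st : List ℕ}, s ∈ vpaRests R → (vpaOf a₀ R starts).Run
      (Encodable.encode (false, ([] : List ℕ)), Encodable.encode s :: st) [.ret a₀]
        (Encodable.encode s, st) := by
    intro s st hs
    exact .cons (.pop (List.mem_map.2 ⟨_, hs, rfl⟩)) (.nil _)
  induction h with
  | letter h =>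
    intro s hs st
    refine .cons (.internal ?_) (.nil _)
    exact List.mem_flatMap.2 ⟨_, h, List.mem_flatMap.2 ⟨_, List.mem_singleton_self _,
      List.mem_map.2 ⟨_, hs, rfl⟩⟩⟩
  | leaf h =>
    intro s hs st
    exact .cons (hcall h (List.mem_singleton_self _) hs) (hpop hs)
  | @node N N₁ N₂ u v h hu hv ihu ihv =>
    intro s hs st
    rw [List.map_append, List.map_append, List.map_cons]
    refine VPA.Run.append (VPA.Run.append (.cons (hcall h (List.mem_singleton_self _) hs)
      (ihu (false, [N₂]) ?_ _)) (ihv (false, []) ?_ _)) (hpop hs)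
    · simp only [vpaRests, List.mem_cons, List.mem_flatMap]
      exact .inr (.inr ⟨_, h, by simp [BFGBody.pending]⟩)
    · simp [vpaRests]

theorem mem_vpaOf_language {α : Type} (a₀ : α) (R : List (ℕ × BFGBody α)) (starts : List ℕ)
    (w : List (Tagged α)) :
    w ∈ (vpaOf a₀ R starts).language ↔
      ∃ N ∈ starts, ∃ x, FlatGen R N x ∧ w = x.map (FlatSymbol.toTagged a₀) := by
  constructor
  · rintro ⟨q₀, hq₀, q, hq, s, h⟩
    obtain ⟨N, hN, rfl⟩ := List.mem_map.1 hq₀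
    obtain ⟨_, hx, rfl⟩ := StackGen.exists_of_run h (List.mem_singleton.1 hq) [N] [] rfl
    refine ⟨N, hN, _, ?_, rfl⟩
    cases hx with
    | tree hu hv => cases hv; rwa [List.append_nil]
  · rintro ⟨N, hN, x, hx, rfl⟩
    exact ⟨_, List.mem_map.2 ⟨N, hN, rfl⟩, _, List.mem_singleton_self _, [],
      hx.run a₀ starts (true, []) (by simp [vpaRests]) []⟩

/-- A language is a regular restriction of its union with a disjoint language exactly if it can
be separated from the latter. -/
theorem regularRestriction_iff {α : Type} {L₁ L₂ L : Language α}
    (hL : ∀ w, w ∈ L ↔ w ∈ L₁ ∨ w ∈ L₂) (hd : Disjoint L₁ L₂) :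
    RegularRestriction L L₁ ↔ RegularSeparable L₁ L₂ := by
  constructor
  · rintro ⟨R, hR, h⟩
    have h : ∀ w, w ∈ R ∧ w ∈ L ↔ w ∈ L₁ := fun w => Set.ext_iff.1 h w
    refine ⟨R, hR, fun w hw => ((h w).2 hw).1, fun w hw hw' => ?_⟩
    exact Set.disjoint_left.1 hd ((h w).1 ⟨hw', (hL w).2 (.inr hw)⟩) hw
  · rintro ⟨R, hR, h₁, h₂⟩
    refine ⟨R, hR, Set.ext fun w => ⟨?_, fun h => ⟨h₁ w h, (hL w).2 (.inl h)⟩⟩⟩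
    rintro ⟨hw, h⟩
    obtain h | h := (hL w).1 h
    · exact h
    · exact absurd hw (h₂ w h)

/-! ### Computability of the input word -/

theorem trNat_posNum (p : PosNum) :
    Turing.PartrecToTM2.trNat (p : ℕ) = Turing.PartrecToTM2.trPosNum p := by
  rw [Turing.PartrecToTM2.trNat, PosNum.of_to_nat]
  rfl

/-- The universal machine reads its input in binary, the least significant digit first. -/
theorem trNat_of_ne_zero {n : ℕ} (hn : n ≠ 0) : Turing.PartrecToTM2.trNat n =
    (if n % 2 = 0 then .bit0 else .bit1) :: Turing.PartrecToTM2.trNat (n / 2) := by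
  obtain ⟨m, rfl⟩ : ∃ m : Num, n = (m : ℕ) := ⟨n, (Num.to_of_nat n).symm⟩
  cases m with
  | zero => exact absurd rfl hn
  | pos p =>
    change Turing.PartrecToTM2.trNat (p : ℕ) = (if (p : ℕ) % 2 = 0 then _ else _) ::
      Turing.PartrecToTM2.trNat ((p : ℕ) / 2)
    rw [trNat_posNum]
    cases p with
    | one =>
      change [Turing.PartrecToTM2.Γ'.bit1] = _ :: Turing.PartrecToTM2.trNat 0
      rw [Turing.PartrecToTM2.trNat_zero]
      rfl
    | bit0 p =>
      have h₁ : ((p.bit0 : PosNum) : ℕ) % 2 = 0 := by rw [PosNum.cast_bit0]; omega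
      have h₂ : ((p.bit0 : PosNum) : ℕ) / 2 = p := by rw [PosNum.cast_bit0]; omega
      rw [if_pos h₁, h₂, trNat_posNum]
      rfl
    | bit1 p =>
      have h₁ : ¬ ((p.bit1 : PosNum) : ℕ) % 2 = 0 := by rw [PosNum.cast_bit1]; omega
      have h₂ : ((p.bit1 : PosNum) : ℕ) / 2 = p := by rw [PosNum.cast_bit1]; omega
      rw [if_neg h₁, h₂, trNat_posNum]
      rfl

/-- Each round of the iteration moves a binary digit to the output; `n` rounds are more than
enough, since zero is left unchanged. -/
theorem primrec_map_trNat {β : Type} [Primcodable β] (g : Turing.PartrecToTM2.Γ' → β) :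
    Primrec fun n : ℕ => (Turing.PartrecToTM2.trNat n).map g := by
  let step : ℕ × List β → ℕ × List β := fun s =>
    if s.1 = 0 then s else (s.1 / 2, s.2 ++ [if s.1 % 2 = 0 then g .bit0 else g .bit1])
  have hstep : Primrec step := by
    refine .ite (Primrec.eq.comp .fst (.const 0)) .id (.pair ?_ ?_)
    · exact Primrec.nat_div.comp .fst (.const 2)
    · refine Primrec.list_concat.comp .snd (.ite ?_ (.const _) (.const _))
      exact Primrec.eq.comp (Primrec.nat_mod.comp .fst (.const 2)) (.const 0)
  have hiter : ∀ k m acc, m ≤ k →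
      (step^[k] (m, acc)).2 = acc ++ (Turing.PartrecToTM2.trNat m).map g := by
    intro k
    induction k with
    | zero =>
      intro m acc hm
      obtain rfl : m = 0 := by omega
      simp
    | succ k ih =>
      intro m acc hm
      rw [Function.iterate_succ_apply]
      by_cases h : m = 0
      · subst h
        change (step^[k] (0, acc)).2 = _
        exact ih 0 acc (by omega)
      · have : step (m, acc) =
            (m / 2, acc ++ [if m % 2 = 0 then g .bit0 else g .bit1]) := if_neg h
        rw [this, ih _ _ (by omega), trNat_of_ne_zero h]
        split_ifs <;> simp
  refine (Primrec.snd.comp (Primrec.nat_iterate (f := fun n : ℕ => n)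
    (g := fun n : ℕ => (n, ([] : List β))) (h := fun _ => step) .id (.pair .id (.const []))
    (hstep.comp .snd))).of_eq fun n => ?_
  simpa using hiter n n [] le_rfl

/-! ### Computability of the grammars -/

/-- Right-hand sides of tree productions as plain data. -/
abbrev BodyCode : Type := ℕ ⊕ Unit ⊕ ℕ × ℕ

/-- The list of productions of a binary flattened tree grammar as plain data. -/
def codeRules {k : ℕ} (R : List (ℕ × BFGBody (Fin k))) : List (ℕ × BodyCode) :=
  R.map fun r => (r.1, r.2.code)

/-- The effect of `padRule` on plain data. -/
def padCode (M : ℕ) (b : BodyCode) : List (ℕ × BodyCode) :=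
  [(M + 1, b), (M + 1, .inr (.inr (0, M + 1))), (M + 1, .inr (.inr (M + 1, 0)))]

theorem primrec_padCode : Primrec₂ padCode := by
  have h : Primrec fun p : ℕ × BodyCode => p.1 + 1 := Primrec.succ.comp .fst
  refine Primrec.list_cons.comp (.pair h .snd) (Primrec.list_cons.comp (.pair h ?_)
    (Primrec.list_cons.comp (.pair h ?_) (.const [])))
  · exact Primrec.sumInr.comp (Primrec.sumInr.comp (.pair (.const 0) h))
  · exact Primrec.sumInr.comp (Primrec.sumInr.comp (.pair h (.const 0)))

/-- Numbers for the nonterminals of `pairRules`. -/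
def ntNumber {α : Type} [Encodable α] : CFExpr α ⊕ ℕ → ℕ
  | .inl e => 2 * Encodable.encode e
  | .inr i => 2 * i + 1

theorem ntNumber_injective {α : Type} [Encodable α] :
    Function.Injective (ntNumber : CFExpr α ⊕ ℕ → ℕ) := by
  rintro (e | i) (e' | j) h
  · simp only [ntNumber] at h
    rw [Encodable.encode_injective (show Encodable.encode e = Encodable.encode e' by omega)]
  · simp only [ntNumber] at h; omega
  · simp only [ntNumber] at h; omega
  · simp only [ntNumber] at h
    rw [show i = j by omega]

/-- The tree productions for `prependRules` as plain data, together with the length of the word;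
`P` is the number of the nonterminal of the given expression and `g` numbers the nonterminals of
letters. -/
def prependCode {k : ℕ} (P : ℕ) (g : Fin k → ℕ) (x : List (Fin k)) : List (ℕ × BodyCode) × ℕ :=
  x.foldr (fun a s =>
    (padCode (2 * (s.2 + 1) + 1) (.inr (.inr (g a + 1, 2 * s.2 + 1 + 1))) ++
      (padCode (g a) (.inl a) ++ s.1), s.2 + 1))
    (padCode 1 (.inr (.inr (0, P + 1))), 0)

theorem primrec_prependCode {k : ℕ} (P : ℕ) (g : Fin k → ℕ) : Primrec (prependCode P g) := by
  refine Primrec.list_foldr (g := fun _ : List (Fin k) => (padCode 1 (.inr (.inr (0, P + 1))), 0))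
    (h := fun _ (p : Fin k × (List (ℕ × BodyCode) × ℕ)) =>
      (padCode (2 * (p.2.2 + 1) + 1) (.inr (.inr (g p.1 + 1, 2 * p.2.2 + 1 + 1))) ++
        (padCode (g p.1) (.inl p.1) ++ p.2.1), p.2.2 + 1)) .id (.const _) ?_
  have ha : Primrec fun q : List (Fin k) × (Fin k × (List (ℕ × BodyCode) × ℕ)) => q.2.1 :=
    Primrec.fst.comp .snd
  have hg : Primrec fun q : List (Fin k) × (Fin k × (List (ℕ × BodyCode) × ℕ)) => g q.2.1 :=
    (Primrec.dom_finite g).comp ha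
  have hi : Primrec fun q : List (Fin k) × (Fin k × (List (ℕ × BodyCode) × ℕ)) => q.2.2.2 :=
    Primrec.snd.comp (Primrec.snd.comp .snd)
  refine Primrec.pair (Primrec.list_append.comp (primrec_padCode.comp
    (Primrec.nat_double_succ.comp (Primrec.succ.comp hi)) ?_) (Primrec.list_append.comp
      (primrec_padCode.comp hg ?_) (Primrec.fst.comp (Primrec.snd.comp .snd))))
    (Primrec.succ.comp hi)
  · exact Primrec.sumInr.comp (Primrec.sumInr.comp (.pair (Primrec.succ.comp hg)
      (Primrec.succ.comp (Primrec.nat_double_succ.comp hi))))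
  · exact Primrec.sumInl.comp (Primrec.fin_val.comp ha)

theorem prependCode_eq {α : Type} [Encodable α] {k : ℕ} (ε : α ≃ Fin k) (e : CFExpr α)
    (x : List α) :
    prependCode (ntNumber (.inl e)) (fun a => ntNumber (.inl (.letter (ε.symm a)))) (x.map ε) =
      (codeRules ((mapRules ntNumber ε (prependRules e x)).flatMap padRule), x.length) := by
  induction x with
  | nil => rfl
  | cons a x ih =>
    rw [List.map_cons, prependCode, List.foldr_cons, ← prependCode, ih]
    simp only [prependRules, mapRules, codeRules, List.map_cons, List.flatMap_cons,
      List.map_append, List.length_cons, Equiv.symm_apply_apply]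
    rfl

/-! ### Computability of the automata -/

/-- `BFGBody.letters` on plain data. -/
def BodyCode.letters (b : BodyCode) : List ℕ :=
  Sum.casesOn b (fun t => [t]) fun _ => []

/-- `BFGBody.children` on plain data. -/
def BodyCode.children (b : BodyCode) : List (List ℕ) :=
  Sum.casesOn b (fun _ => []) fun c => Sum.casesOn c (fun _ => [[]]) fun p => [[p.1, p.2]]

/-- `BFGBody.pending` on plain data. -/
def BodyCode.pending (b : BodyCode) : List (List ℕ) :=
  Sum.casesOn b (fun _ => []) fun c => Sum.casesOn c (fun _ => []) fun p => [[p.2]]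

theorem primrec_letters : Primrec BodyCode.letters :=
  Primrec.sumCasesOn .id (Primrec.list_cons.comp .snd (.const [])) (.const [])

theorem primrec_children : Primrec BodyCode.children := by
  refine Primrec.sumCasesOn .id (.const []) (Primrec.sumCasesOn .snd (.const [[]]) ?_)
  refine Primrec.list_cons.comp (Primrec.list_cons.comp ?_ (Primrec.list_cons.comp ?_ (.const [])))
    (.const [])
  · exact Primrec.fst.comp .snd
  · exact Primrec.snd.comp .snd

theorem primrec_pending : Primrec BodyCode.pending := by
  refine Primrec.sumCasesOn .id (.const []) (Primrec.sumCasesOn .snd (.const []) ?_)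
  exact Primrec.list_cons.comp (Primrec.list_cons.comp (Primrec.snd.comp .snd) (.const []))
    (.const [])

/-- `vpaRests` on plain data. -/
def restsCode (R : List (ℕ × BodyCode)) : List (Bool × List ℕ) :=
  (true, []) :: (false, []) :: R.flatMap fun r => (BodyCode.pending r.2).map fun l => (false, l)

theorem primrec_restsCode : Primrec restsCode := by
  refine Primrec.list_cons.comp (.const _) (Primrec.list_cons.comp (.const _)
    (Primrec.list_flatMap .id (Primrec.list_map ?_ ?_)))
  · exact primrec_pending.comp (Primrec.snd.comp .snd)
  · exact Primrec.pair (.const false) .snd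

/-- Automata as plain data. -/
abbrev VPACode : Type :=
  List ℕ × List ℕ × List (ℕ × ℕ × ℕ × ℕ) × List (ℕ × ℕ × ℕ) × List (ℕ × ℕ × Option ℕ × ℕ)

/-- The automaton `vpaOf` on plain data. -/
def vpaCode (R : List (ℕ × BodyCode)) (starts : List ℕ) : VPACode :=
  (starts.map fun N => Encodable.encode (true, [N]),
    [Encodable.encode (true, ([] : List ℕ))],
    R.flatMap fun r => (BodyCode.children r.2).flatMap fun l => (restsCode R).map fun s =>
      (Encodable.encode (s.1, r.1 :: s.2), 0, Encodable.encode (false, l), Encodable.encode s),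
    R.flatMap fun r => (BodyCode.letters r.2).flatMap fun t => (restsCode R).map fun s =>
      (Encodable.encode (s.1, r.1 :: s.2), t, Encodable.encode s),
    (restsCode R).map fun s =>
      (Encodable.encode (false, ([] : List ℕ)), 0, some (Encodable.encode s),
        Encodable.encode s))

theorem primrec_vpaCode : Primrec₂ vpaCode := by
  refine Primrec.pair ?_ (.pair (.const _) (.pair ?_ (.pair ?_ ?_)))
  · refine Primrec.list_map .snd (Primrec.encode.comp (.pair (.const true) ?_))
    exact Primrec.list_cons.comp .snd (.const [])
  · refine Primrec.list_flatMap .fst (Primrec.list_flatMap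
      (primrec_children.comp (Primrec.snd.comp .snd)) (Primrec.list_map
        (primrec_restsCode.comp (Primrec.fst.comp (Primrec.fst.comp .fst))) ?_))
    refine Primrec.pair (Primrec.encode.comp (.pair (Primrec.fst.comp .snd) (Primrec.list_cons.comp
      (Primrec.fst.comp (Primrec.snd.comp (Primrec.fst.comp .fst))) (Primrec.snd.comp .snd))))
        (.pair (.const 0) (.pair ?_ (Primrec.encode.comp .snd)))
    exact Primrec.encode.comp (.pair (.const false) (Primrec.snd.comp .fst))
  · refine Primrec.list_flatMap .fst (Primrec.list_flatMap
      (primrec_letters.comp (Primrec.snd.comp .snd)) (Primrec.list_map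
        (primrec_restsCode.comp (Primrec.fst.comp (Primrec.fst.comp .fst))) ?_))
    exact Primrec.pair (Primrec.encode.comp (.pair (Primrec.fst.comp .snd) (Primrec.list_cons.comp
      (Primrec.fst.comp (Primrec.snd.comp (Primrec.fst.comp .fst))) (Primrec.snd.comp .snd))))
        (.pair (Primrec.snd.comp .fst) (Primrec.encode.comp .snd))
  · refine Primrec.list_map (primrec_restsCode.comp .fst) ?_
    exact Primrec.pair (.const _) (.pair (.const 0) (.pair
      (Primrec.option_some.comp (Primrec.encode.comp .snd)) (Primrec.encode.comp .snd)))

theorem vpaOf_code {k : ℕ} (R : List (ℕ × BFGBody (Fin (k + 1)))) (starts : List ℕ) :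
    (vpaOf 0 R starts).code = vpaCode (codeRules R) starts := by
  have hp : ∀ b : BFGBody (Fin (k + 1)), BodyCode.pending b.code = b.pending := by
    intro b; cases b <;> rfl
  have hc : ∀ b : BFGBody (Fin (k + 1)), BodyCode.children b.code = b.children := by
    intro b; cases b <;> rfl
  have hl : ∀ b : BFGBody (Fin (k + 1)), BodyCode.letters b.code = b.letters.map Fin.val := by
    intro b; cases b <;> rfl
  have hr : restsCode (codeRules R) = vpaRests R := by
    simp only [restsCode, vpaRests, codeRules, List.flatMap_map, hp]
  simp only [VPA.code, vpaCode, vpaOf, hr]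
  simp only [codeRules, List.flatMap_map, List.map_flatMap, List.map_map, hc, hl,
    Function.comp_def, Fin.val_zero]

/-! ### The reductions -/

/-- The halting problem reduces to separability of two languages of words which are given by a
common list of productions, computable from the program. -/
theorem exists_reduction : ∃ (k : ℕ) (R : ℕ → List (ℕ × CFBody ℕ (Fin (k + 1)))) (s₁ : ℕ → ℕ)
    (s₂ : ℕ), Primrec (fun n => codeRules (padRules (R n))) ∧ Primrec s₁ ∧
    (∀ n x, Gen (R n) (s₁ n) x → ¬ Gen (R n) s₂ x) ∧
    ∀ n, RegularSeparable ({x | Gen (R n) (s₁ n) x} : Language (Fin (k + 1)))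
        ({x | Gen (R n) s₂ x} : Language (Fin (k + 1))) ↔
      (Nat.Partrec.Code.eval (Denumerable.ofNat Nat.Partrec.Code n) 0).Dom := by
  obtain ⟨γ, _, C, step, enc, ρ, init, sym, pre, post, hr, hinit, hdom⟩ :=
    exists_universal_rewriting
  classical
  have hcard : 0 < Fintype.card (ChainSymbol γ) := Fintype.card_pos_iff.2 ⟨.sep⟩
  obtain ⟨k, hk⟩ := Nat.exists_eq_succ_of_ne_zero hcard.ne'
  let ε : ChainSymbol γ ≃ Fin (k + 1) := Fintype.equivFinOfCardEq hk
  let _ : Encodable (ChainSymbol γ) := Encodable.ofEquiv _ ε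
  let x : ℕ → List (ChainSymbol γ) := fun n => block (enc (init n)) ++ [.sep]
  let R : ℕ → List (ℕ × CFBody ℕ (Fin (k + 1))) := fun n =>
    mapRules ntNumber ε (pairRules (backwardExpr ρ) (forwardExpr ρ) (x n))
  have hx : Primrec fun n => (x n).map ε := by
    have hmap := primrec_map_trNat fun a => ε (.letter (sym a))
    refine (Primrec.list_append.comp (Primrec.list_append.comp
      (.const ((block pre).map ε)) hmap)
        (.const ((block post ++ [ChainSymbol.sep]).map ε))).of_eq fun n => ?_
    simp [x, hinit, block, Function.comp_def]
  have h₁ : ∀ n w, Gen (R n) (ntNumber (.inr (x n).length : CFExpr (ChainSymbol γ) ⊕ ℕ)) w ↔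
      ∃ z ∈ ({w | ∃ u, BackwardChain (Rewrites ρ) 0 u ∧ w = block (enc (init n)) ++ .sep :: u} :
        Language (ChainSymbol γ)), w = z.map ε := by
    intro n w
    rw [gen_mapRules_iff ntNumber_injective]
    simp only [gen_pairRules_inr, mem_backwardExpr, x, List.append_assoc, List.singleton_append]
    rfl
  have h₂ : ∀ n w, Gen (R n) (ntNumber (.inl (forwardExpr ρ))) w ↔
      ∃ z ∈ ({w | ForwardChain (Rewrites ρ) 0 w} : Language (ChainSymbol γ)), w = z.map ε := by
    intro n w
    rw [gen_mapRules_iff ntNumber_injective]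
    simp only [gen_pairRules_inl _ _ _ (.inr rfl), mem_forwardExpr]
    rfl
  refine ⟨k, R, fun n => ntNumber (.inr (x n).length : CFExpr (ChainSymbol γ) ⊕ ℕ),
    ntNumber (.inl (forwardExpr ρ)), ?_, ?_, ?_, ?_⟩
  · refine (Primrec.list_append.comp (.const (codeRules (padRules
      (mapRules ntNumber ε (mapRules .inl id
        ((backwardExpr ρ).rules ++ (forwardExpr ρ).rules)))))) (Primrec.fst.comp
          ((primrec_prependCode (ntNumber (.inl (backwardExpr ρ)))
            fun a => ntNumber (.inl (.letter (ε.symm a)))).comp hx))).of_eq fun n => ?_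
    rw [prependCode_eq ε (backwardExpr ρ) (x n)]
    simp [R, pairRules, padRules, mapRules, codeRules]
  · refine (Primrec.nat_double_succ.comp (Primrec.list_length.comp hx)).of_eq fun n => ?_
    simp [ntNumber]
  · intro n w hw hw'
    obtain ⟨_, ⟨u, hu, rfl⟩, rfl⟩ := (h₁ n w).1 hw
    obtain ⟨z, hz, h⟩ := (h₂ n _).1 hw'
    obtain rfl := List.map_injective_iff.2 ε.injective h
    exact hu.not_forwardChain hz
  · intro n
    refine (regularSeparable_map_iff ε.left_inv (h₁ n) (h₂ n)).trans ?_
    rw [← hdom]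
    constructor
    · intro h
      by_contra hn
      exact not_regularSeparable_of_not_dom hr hn h
    · intro h
      exact (prefixSeparated_of_dom hr h 0).regularSeparable

/-- A problem to which the halting problem reduces is undecidable. -/
theorem not_decidableProblem {ι α : Type} [Primcodable α] {code : ι → α}
    {promise answer : ι → Prop} (inst : ℕ → ι) (hcode : Primrec fun n => code (inst n))
    (hp : ∀ n, promise (inst n)) (ha : ∀ n, answer (inst n) ↔
      (Nat.Partrec.Code.eval (Denumerable.ofNat Nat.Partrec.Code n) 0).Dom) :
    ¬ DecidableProblem code promise answer := by
  rintro ⟨f, hf, h⟩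
  choose b hb hb' using fun c : Nat.Partrec.Code => h (inst (Encodable.encode c)) (hp _)
  have hb'' : ∀ c, b c = true ↔ (Nat.Partrec.Code.eval c 0).Dom := fun c => by
    rw [hb', ha, Denumerable.ofNat_encode]
  have hcomp : Computable b := by
    refine (hf.comp (hcode.to_comp.comp Computable.encode)).of_eq fun c => ?_
    exact Part.eq_some_iff.2 (hb c)
  let _ : DecidablePred fun c => (Nat.Partrec.Code.eval c 0).Dom :=
    fun c => decidable_of_iff _ (hb'' c)
  refine ComputablePred.halting_problem 0 ⟨inferInstance, hcomp.of_eq fun c => ?_⟩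
  rw [Bool.eq_iff_iff, hb'', decide_eq_true_iff]

/-- Regular separability of two disjoint languages is undecidable, both for languages given by
binary flattened tree grammars and for languages given by visibly pushdown automata; moreover it
is undecidable whether one language of nested words is a regular restriction of another. -/
theorem theorem2p4 :
    ¬ DecidableProblem BFGPair.code
        (fun p => Disjoint p.fst.language p.snd.language)
        (fun p => RegularSeparable p.fst.language p.snd.language) ∧
    ¬ DecidableProblem VPAPair.code
        (fun p => Disjoint p.fst.language p.snd.language)
        (fun p => RegularSeparable p.fst.language p.snd.language) ∧
    ¬ DecidableProblem VPAPair.code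
        (fun _ => True)
        (fun p => RegularRestriction p.fst.language p.snd.language) := by
  obtain ⟨k, R, s₁, s₂, hR, hs₁, hdisj, hsep⟩ := exists_reduction
  let L₁ : ℕ → Language (FlatSymbol (Fin (k + 1))) := fun n =>
    BFG.language ⟨s₁ n + 1, padRules (R n)⟩
  let L₂ : ℕ → Language (FlatSymbol (Fin (k + 1))) := fun n =>
    BFG.language ⟨s₂ + 1, padRules (R n)⟩
  have hL : ∀ n, Disjoint (L₁ n) (L₂ n) := fun n => disjoint_padRules _ _ _ (hdisj n)
  have hLsep : ∀ n, RegularSeparable (L₁ n) (L₂ n) ↔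
      (Nat.Partrec.Code.eval (Denumerable.ofNat Nat.Partrec.Code n) 0).Dom := fun n =>
    (regularSeparable_padRules_iff _ _ _).trans (hsep n)
  let V : ℕ → List ℕ → VPA (Fin (k + 1)) := fun n starts => vpaOf 0 (padRules (R n)) starts
  have hV₁ : ∀ n w, w ∈ (V n [s₁ n + 1]).language ↔
      ∃ x ∈ L₁ n, w = x.map (FlatSymbol.toTagged 0) := by
    intro n w
    simp [V, L₁, mem_vpaOf_language, BFG.mem_language_iff]
  have hV₂ : ∀ n w, w ∈ (V n [s₂ + 1]).language ↔
      ∃ x ∈ L₂ n, w = x.map (FlatSymbol.toTagged 0) := by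
    intro n w
    simp [V, L₂, mem_vpaOf_language, BFG.mem_language_iff]
  have hV : ∀ n w, w ∈ (V n [s₁ n + 1, s₂ + 1]).language ↔
      w ∈ (V n [s₁ n + 1]).language ∨ w ∈ (V n [s₂ + 1]).language := by
    intro n w
    simp [V, mem_vpaOf_language]
  have hVdisj : ∀ n, Disjoint (V n [s₁ n + 1]).language (V n [s₂ + 1]).language := by
    refine fun n => Set.disjoint_left.2 fun w h₁ h₂ => ?_
    obtain ⟨x, hx, rfl⟩ := (hV₁ n w).1 h₁
    obtain ⟨y, hy, h⟩ := (hV₂ n _).1 h₂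
    obtain rfl := List.map_injective_iff.2 (Tagged.toFlat_toTagged 0).injective h
    exact Set.disjoint_left.1 (hL n) hx hy
  have hVsep : ∀ n, RegularSeparable (V n [s₁ n + 1]).language (V n [s₂ + 1]).language ↔
      (Nat.Partrec.Code.eval (Denumerable.ofNat Nat.Partrec.Code n) 0).Dom := fun n =>
    (regularSeparable_map_iff (Tagged.toFlat_toTagged 0) (hV₁ n) (hV₂ n)).trans (hLsep n)
  have hs₁' : Primrec fun n => s₁ n + 1 := Primrec.succ.comp hs₁
  have hone : Primrec fun n => [s₁ n + 1] := Primrec.list_cons.comp hs₁' (.const [])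
  have htwo : Primrec fun n => [s₁ n + 1, s₂ + 1] := Primrec.list_cons.comp hs₁' (.const [s₂ + 1])
  have hVcode : ∀ {starts : ℕ → List ℕ}, Primrec starts →
      Primrec fun n => (V n (starts n)).code := fun h =>
    (primrec_vpaCode.comp hR h).of_eq fun n => (vpaOf_code _ _).symm
  refine ⟨?_, ?_, ?_⟩
  · exact not_decidableProblem (ι := BFGPair) (fun n => ⟨k + 1, ⟨s₁ n + 1, padRules (R n)⟩,
      ⟨s₂ + 1, padRules (R n)⟩⟩) (.pair (.const _) (.pair (.pair hs₁' hR) (.pair (.const _) hR)))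
      hL hLsep
  · exact not_decidableProblem (ι := VPAPair)
      (fun n => ⟨k + 1, V n [s₁ n + 1], V n [s₂ + 1]⟩)
      (.pair (.const _) (.pair (hVcode hone) (hVcode (.const _)))) hVdisj hVsep
  · exact not_decidableProblem (ι := VPAPair)
      (fun n => ⟨k + 1, V n [s₁ n + 1, s₂ + 1], V n [s₁ n + 1]⟩)
      (.pair (.const _) (.pair (hVcode htwo) (hVcode hone))) (fun _ => trivial)
      fun n => (regularRestriction_iff (hV n) (hVdisj n)).trans (hVsep n)
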